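/- Let $\mathrm{Aut}(\mathbb{C}^n)$ be the group of polynomial automorphisms of $\mathbb{C}^n$ (bijections that are polynomial together with their inverse, under composition). Let $\omega=z_0\,\mathrm{d}z_1+\mathrm{d}z_2$ on $\mathbb{C}^3$ and $\eta=\mathrm{d}z_0\wedge\mathrm{d}z_1$ on $\mathbb{C}^2$, and put $$\mathrm{Aut}(\mathbb{C}^3)_\omega=\{\phi \mid \phi^*\omega=\omega\},\qquad \mathrm{Aut}(\mathbb{C}^3)_{c(\omega)}=\{\phi\mid \phi^*\omega\wedge\omega=0\},\qquad \mathrm{Aut}(\mathbb{C}^2)_\eta=\{\varphi\mid\varphi^*\eta=\eta\}.$$ A group is perfect if it equals its derived (commutator) subgroup. Then: (1) The derived groups $[\mathrm{Aut}(\mathbb{C}^3)_\omega,\mathrm{Aut}(\mathbb{C}^3)_\omega]$ and $[\mathrm{Aut}(\mathbb{C}^3)_{c(\omega)},\mathrm{Aut}(\mathbb{C}^3)_{c(\omega)}]$ are perfect. (2) The group $\mathrm{Aut}(\mathbb{C}^2)_\eta$ is perfect. (3) For every $\phi=(\phi_0,\phi_1,\phi_2)$ in $\mathrm{Aut}(\mathbb{C}^3)_{c(\omega)}$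 the components $\phi_0,\phi_1$ depend only on $(z_0,z_1)$, and $\phi\mapsto(\phi_0,\phi_1)$ defines group homomorphisms $\varsigma\colon\mathrm{Aut}(\mathbb{C}^3)_\omega\to\mathrm{Aut}(\mathbb{C}^2)_\eta$ and $\varsigma\colon\mathrm{Aut}(\mathbb{C}^3)_{c(\omega)}\to\mathrm{Aut}(\mathbb{C}^2)$. Each of them maps the derived group of its source onto $\mathrm{Aut}(\mathbb{C}^2)_\eta$, and the kernel of its restriction to this derived group is exactly the group of all translations $(z_0,z_1,z_2+b)$ with $b\in\mathbb{C}$. That is, if $D$ denotes either derived group, there is an exact sequence $0\to\mathbb{C}\to D\stackrel{\varsigma}{\longrightarrow}\mathrm{Aut}(\mathbb{C}^2)_\eta\to1$. -/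

import Mathlib

noncomputable section

namespace ContactAut

/-- The affine space `ℂⁿ` with coordinates `z 0, …, z (n - 1)`. -/
abbrev Aff (n : ℕ) : Type := Fin n → ℂ

/-- Polynomial maps `ℂⁿ → ℂᵐ`. -/
def IsPolyMap {n m : ℕ} (f : Aff n → Aff m) : Prop :=
  ∃ P : Fin m → MvPolynomial (Fin n) ℂ, ∀ z i, f z i = MvPolynomial.eval z (P i)

theorem isPolyMap_id (n : ℕ) : IsPolyMap (fun z : Aff n => z) :=
  ⟨fun i => MvPolynomial.X i, fun z i => by simp⟩

theorem IsPolyMap.comp {n m k : ℕ} {g : Aff m → Aff k} {f : Aff n → Aff m}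
    (hg : IsPolyMap g) (hf : IsPolyMap f) : IsPolyMap (fun z => g (f z)) := by
  obtain ⟨P, hP⟩ := hf
  obtain ⟨Q, hQ⟩ := hg
  refine ⟨fun i => MvPolynomial.bind₁ P (Q i), fun z i => ?_⟩
  have h : f z = fun j => MvPolynomial.eval z (P j) := funext (hP z)
  change g (f z) i = MvPolynomial.eval z (MvPolynomial.bind₁ P (Q i))
  rw [hQ, h]
  change _ = MvPolynomial.eval₂Hom (RingHom.id ℂ) z (MvPolynomial.bind₁ P (Q i))
  rw [MvPolynomial.eval₂Hom_bind₁]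
  rfl

theorem IsPolyMap.differentiable {n m : ℕ} {f : Aff n → Aff m} (hf : IsPolyMap f) :
    Differentiable ℂ f := by
  obtain ⟨P, hP⟩ := hf
  rw [differentiable_pi]
  intro i
  have h : (fun z => f z i) = fun z => MvPolynomial.eval z (P i) := funext fun z => hP z i
  rw [h]
  intro z
  exact (AnalyticAt.aeval_mvPolynomial (𝕜 := ℂ) (z := z)
    (f := fun z : Aff n => z) (fun j => (ContinuousLinearMap.proj (R := ℂ) j).analyticAt z)
    (P i)).differentiableAt

/-- The group `Aut(ℂⁿ)` of polynomial automorphisms of `ℂⁿ`, i.e. bijections of `ℂⁿ` that are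
polynomial together with their inverse; the group law is composition. -/
def polyAut (n : ℕ) : Subgroup (Equiv.Perm (Aff n)) where
  carrier := {φ | IsPolyMap (fun z => φ z) ∧ IsPolyMap (fun z => φ.symm z)}
  mul_mem' := fun ha hb => ⟨ha.1.comp hb.1, hb.2.comp ha.2⟩
  one_mem' := ⟨isPolyMap_id n, isPolyMap_id n⟩
  inv_mem' := fun ha => ⟨ha.2, ha.1⟩

/-- The underlying map of a polynomial automorphism. -/
def toMap {n : ℕ} (φ : polyAut n) : Aff n → Aff n := fun z => (φ : Equiv.Perm (Aff n)) z

theorem toMap_differentiable {n : ℕ} (φ : polyAut n) : Differentiable ℂ (toMap φ) :=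
  IsPolyMap.differentiable φ.2.1

theorem toMap_one {n : ℕ} : toMap (1 : polyAut n) = fun z => z := rfl

theorem toMap_mul {n : ℕ} (φ ψ : polyAut n) : toMap (φ * ψ) = toMap φ ∘ toMap ψ := rfl

theorem toMap_inv_apply {n : ℕ} (φ : polyAut n) (z : Aff n) : toMap φ⁻¹ (toMap φ z) = z :=
  Equiv.symm_apply_apply (φ : Equiv.Perm (Aff n)) z

/-- `1`-forms on `ℂⁿ`. -/
abbrev OneForm (n : ℕ) : Type := Aff n → (Aff n →L[ℂ] ℂ)

/-- `2`-forms on `ℂⁿ`. -/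
abbrev TwoForm (n : ℕ) : Type := Aff n → (Aff n [⋀^Fin 2]→L[ℂ] ℂ)

/-- The coordinate form `dz_i`. -/
def dz {n : ℕ} (i : Fin n) : OneForm n := fun _ => ContinuousLinearMap.proj i

/-- The wedge product of two linear forms: the alternatization of `(u, v) ↦ α u * β v`. -/
def wedgeLin {n : ℕ} (α β : Aff n →L[ℂ] ℂ) : Aff n [⋀^Fin 2]→L[ℂ] ℂ :=
  ContinuousMultilinearMap.alternatization
    ((ContinuousMultilinearMap.mkPiAlgebra ℂ (Fin 2) ℂ).compContinuousLinearMap ![α, β])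

theorem wedgeLin_apply {n : ℕ} (α β : Aff n →L[ℂ] ℂ) (v : Fin 2 → Aff n) :
    wedgeLin α β v = α (v 0) * β (v 1) - α (v 1) * β (v 0) := by
  have h : (Finset.univ : Finset (Equiv.Perm (Fin 2))) = {1, Equiv.swap 0 1} := by decide
  rw [wedgeLin, ContinuousMultilinearMap.alternatization_apply_apply, h,
    Finset.sum_pair (by decide)]
  simp [Fin.prod_univ_two, sub_eq_add_neg]

/-- The wedge product of two `1`-forms. -/
def wedge {n : ℕ} (α β : OneForm n) : TwoForm n := fun z => wedgeLin (α z) (β z)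

/-- The pullback `f^*β` of a `1`-form. -/
def pullback₁ {n : ℕ} (f : Aff n → Aff n) (β : OneForm n) : OneForm n :=
  fun z => (β (f z)).comp (fderiv ℂ f z)

/-- The pullback `f^*β` of a `2`-form. -/
def pullback₂ {n : ℕ} (f : Aff n → Aff n) (β : TwoForm n) : TwoForm n :=
  fun z => (β (f z)).compContinuousLinearMap (fderiv ℂ f z)

theorem pullback₁_id {n : ℕ} (β : OneForm n) : pullback₁ (fun z => z) β = β := by
  funext z
  ext v
  simp [pullback₁]

theorem pullback₂_id {n : ℕ} (β : TwoForm n) : pullback₂ (fun z => z) β = β := by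
  funext z
  ext v
  simp [pullback₂]

theorem pullback₁_mul {n : ℕ} (φ ψ : polyAut n) (β : OneForm n) :
    pullback₁ (toMap (φ * ψ)) β = pullback₁ (toMap ψ) (pullback₁ (toMap φ) β) := by
  funext z
  ext v
  simp only [pullback₁, toMap_mul]
  rw [fderiv_comp z (toMap_differentiable φ _) (toMap_differentiable ψ _)]
  rfl

theorem pullback₂_mul {n : ℕ} (φ ψ : polyAut n) (β : TwoForm n) :
    pullback₂ (toMap (φ * ψ)) β = pullback₂ (toMap ψ) (pullback₂ (toMap φ) β) := by
  funext z
  ext v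
  simp only [pullback₂, toMap_mul]
  rw [fderiv_comp z (toMap_differentiable φ _) (toMap_differentiable ψ _)]
  rfl

/-- The group `Aut(ℂⁿ)_β` of polynomial automorphisms `φ` with `φ^*β = β`, for a `1`-form `β`. -/
def autOneForm {n : ℕ} (β : OneForm n) : Subgroup (polyAut n) where
  carrier := {φ | pullback₁ (toMap φ) β = β}
  mul_mem' := by
    intro φ ψ hφ hψ
    rw [Set.mem_ofPred_eq] at *
    rw [pullback₁_mul, hφ, hψ]
  one_mem' := pullback₁_id β
  inv_mem' := by
    intro φ hφ
    rw [Set.mem_ofPred_eq] at *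
    have h := pullback₁_mul φ φ⁻¹ β
    rw [mul_inv_cancel, hφ, toMap_one, pullback₁_id] at h
    exact h.symm

/-- The group `Aut(ℂⁿ)_β` of polynomial automorphisms `φ` with `φ^*β = β`, for a `2`-form `β`. -/
def autTwoForm {n : ℕ} (β : TwoForm n) : Subgroup (polyAut n) where
  carrier := {φ | pullback₂ (toMap φ) β = β}
  mul_mem' := by
    intro φ ψ hφ hψ
    rw [Set.mem_ofPred_eq] at *
    rw [pullback₂_mul, hφ, hψ]
  one_mem' := pullback₂_id β
  inv_mem' := by
    intro φ hφ
    rw [Set.mem_ofPred_eq] at *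
    have h := pullback₂_mul φ φ⁻¹ β
    rw [mul_inv_cancel, hφ, toMap_one, pullback₂_id] at h
    exact h.symm

theorem wedgeLin_eq_zero_iff {n : ℕ} {α β : Aff n →L[ℂ] ℂ} (hβ : β ≠ 0) :
    wedgeLin α β = 0 ↔ ∃ c : ℂ, α = c • β := by
  constructor
  · intro h
    obtain ⟨u, hu⟩ : ∃ u, β u ≠ 0 := by
      by_contra! hc
      exact hβ (ContinuousLinearMap.ext hc)
    refine ⟨α u / β u, ContinuousLinearMap.ext fun v => ?_⟩
    have h2 := wedgeLin_apply α β ![u, v]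
    rw [h] at h2
    change 0 = α u * β v - α v * β u at h2
    change α v = α u / β u * β v
    field_simp
    linear_combination h2
  · rintro ⟨c, rfl⟩
    ext v
    rw [wedgeLin_apply]
    change c * β (v 0) * β (v 1) - c * β (v 1) * β (v 0) = 0
    ring

theorem wedge_eq_zero_iff {n : ℕ} {α β : OneForm n} (hβ : ∀ z, β z ≠ 0) :
    wedge α β = 0 ↔ ∀ z, ∃ c : ℂ, α z = c • β z := by
  rw [funext_iff]
  exact forall_congr' fun z => wedgeLin_eq_zero_iff (hβ z)

/-- The group `Aut(ℂⁿ)_{c(β)}` of polynomial automorphisms `φ` with `φ^*β ∧ β = 0`, for a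
nowhere vanishing `1`-form `β`. -/
def autContact {n : ℕ} (β : OneForm n) (hβ : ∀ z, β z ≠ 0) : Subgroup (polyAut n) where
  carrier := {φ | wedge (pullback₁ (toMap φ) β) β = 0}
  mul_mem' := by
    intro φ ψ hφ hψ
    rw [Set.mem_ofPred_eq, wedge_eq_zero_iff hβ] at *
    intro z
    obtain ⟨c, hc⟩ := hφ (toMap ψ z)
    obtain ⟨d, hd⟩ := hψ z
    refine ⟨c * d, ?_⟩
    rw [pullback₁_mul, mul_smul, ← hd]
    change (pullback₁ (toMap φ) β (toMap ψ z)).comp _ = _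
    rw [hc, ContinuousLinearMap.smul_comp]
    rfl
  one_mem' := by
    rw [Set.mem_ofPred_eq, wedge_eq_zero_iff hβ, toMap_one, pullback₁_id]
    exact fun z => ⟨1, (one_smul _ _).symm⟩
  inv_mem' := by
    intro φ hφ
    rw [Set.mem_ofPred_eq, wedge_eq_zero_iff hβ] at *
    intro w
    obtain ⟨c, hc⟩ := hφ (toMap φ⁻¹ w)
    have h := congrFun (pullback₁_mul φ φ⁻¹ β) w
    rw [mul_inv_cancel, toMap_one, pullback₁_id] at h
    change β w = (pullback₁ (toMap φ) β (toMap φ⁻¹ w)).comp (fderiv ℂ (toMap φ⁻¹) w) at h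
    rw [hc, ContinuousLinearMap.smul_comp] at h
    change β w = c • pullback₁ (toMap φ⁻¹) β w at h
    have hc0 : c ≠ 0 := by
      rintro rfl
      refine hβ w (h.trans ?_)
      ext v
      exact zero_mul _
    exact ⟨c⁻¹, by rw [h, smul_smul, inv_mul_cancel₀ hc0, one_smul]⟩

/-- The standard contact form `ω = z₀ dz₁ + dz₂` on `ℂ³`. -/
def omega : OneForm 3 := fun z => z 0 • dz 1 z + dz 2 z

theorem omega_ne_zero (z : Aff 3) : omega z ≠ 0 := by
  intro h
  have h2 := DFunLike.congr_fun h (Pi.single 2 1)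
  simp [omega, dz] at h2

/-- The form `η = dz₀ ∧ dz₁` on `ℂ²`. -/
def eta : TwoForm 2 := wedge (dz 0) (dz 1)

/-- `Aut(ℂ³)_ω`. -/
abbrev AutOmega : Subgroup (polyAut 3) := autOneForm omega

/-- `Aut(ℂ³)_{c(ω)}`. -/
abbrev AutContactOmega : Subgroup (polyAut 3) := autContact omega omega_ne_zero

/-- `Aut(ℂ²)_η`. -/
abbrev AutEta : Subgroup (polyAut 2) := autTwoForm eta

/-- The projection `ℂ³ → ℂ²` onto the first two coordinates. -/
def proj01 (z : Aff 3) : Aff 2 := ![z 0, z 1]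

/-- `ψ = (φ₀, φ₁)`: the first two components of `φ` depend only on the first two coordinates,
and are given by `ψ`. -/
def IsProjection (φ : polyAut 3) (ψ : polyAut 2) : Prop :=
  ∀ z : Aff 3, toMap ψ (proj01 z) = proj01 (toMap φ z)

/-- `φ = (z₀, z₁, z₂ + b)` for some constant `b`. -/
def IsVerticalTranslation (φ : polyAut 3) : Prop :=
  ∃ b : ℂ, ∀ z : Aff 3, toMap φ z = ![z 0, z 1, z 2 + b]

end ContactAut

end

/-! Everything reduces to the fact that `AutEta` and `AutOmega` are perfect, and that `AutOmega` is
the derived group of `AutContactOmega` as well.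

Contact side. If `φ^*ω = hω`, the chain rule for `φ` and its inverse makes `h` a unit among
polynomials, so `h` is a constant `γ` (`exists_pullback_omega_eq_smul`). These constants are
multiplicative, hence commutators preserve `ω`. Taking `d` gives `dφ₀ ∧ dφ₁ = γ dz₀ ∧ dz₁`: so `φ₀,
φ₁` do not involve `z₂`, the planar map `(φ₀, φ₁)` has Jacobian `γ`, and it is the identity only for
vertical translations (`projHom_eq_one_iff`).

Planar side. By Jung's theorem (`autEta_le`), `AutEta` is generated by the maps `(z₀ + p(z₁), z₁)`
and a rotation. The generators lift to `AutOmega`, which gives surjectivity, and they are products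
of commutators, which gives perfection. Vertical translations are commutators in `AutOmega`, so
perfection passes from `AutEta` up to `AutOmega` (`commutator_strictContact`).

Jung's theorem is proved by locally nilpotent derivations. For `φ` in `AutEta` the derivation `jac
φ₀` is locally nilpotent, and so are its leading forms for all weights. As kernels are factorially
closed, the Newton polygon of `φ₀` is a triangle with corners on the axes, and its edge part has a
factor `z₁^q - c z₀^p` in the kernel, which forces `p = 1` or `q = 1`. A shear then lowers the
degrees of `φ₀` (`exists_shear`), and induction concludes. -/

noncomputable section

namespace ContactAut

open MvPolynomial
open scoped commutatorElement

/-! ### Locally nilpotent derivations -/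

section Nilpotent

variable {R A : Type*} [CommRing R] [CommRing A] [Algebra R A] (D : Derivation R A A)

/-- A derivation is locally nilpotent if every element is killed by some iterate of it. -/
def IsLocallyNilpotent : Prop := ∀ a, ∃ n, (⇑D)^[n] a = 0

theorem iterate_leibniz (n : ℕ) (a b : A) :
    (⇑D)^[n] (a * b) =
      ∑ ij ∈ Finset.HasAntidiagonal.antidiagonal n,
        (n.choose ij.1 : A) * ((⇑D)^[ij.1] a * (⇑D)^[ij.2] b) := by
  induction n with
  | zero => simp
  | succ n ih =>
    rw [Finset.sum_antidiagonal_choose_succ_mul (fun i j => (⇑D)^[i] a * (⇑D)^[j] b),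
      Function.iterate_succ_apply', ih, map_sum, ← Finset.sum_add_distrib]
    refine Finset.sum_congr rfl fun ij hij => ?_
    have h : n.choose ij.2 = n.choose ij.1 := by
      rw [← Finset.HasAntidiagonal.mem_antidiagonal.1 hij, Nat.choose_symm_add]
    simp only [Derivation.leibniz, smul_eq_mul, Function.iterate_succ_apply', h,
      Derivation.map_natCast]
    ring

theorem iterate_eq_zero_of_le {a : A} {m n : ℕ} (h : (⇑D)^[m] a = 0) (hmn : m ≤ n) :
    (⇑D)^[n] a = 0 := by
  obtain ⟨k, rfl⟩ := Nat.exists_eq_add_of_le' hmn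
  rw [Function.iterate_add_apply, h, iterate_map_zero]

/-- The subalgebra of the elements that are killed by some iterate of a derivation. -/
def nilpotentElements : Subalgebra R A where
  carrier := {a | ∃ n, (⇑D)^[n] a = 0}
  mul_mem' := by
    rintro a b ⟨m, hm⟩ ⟨n, hn⟩
    refine ⟨m + n, ?_⟩
    rw [iterate_leibniz]
    refine Finset.sum_eq_zero fun ij hij => ?_
    have := Finset.HasAntidiagonal.mem_antidiagonal.1 hij
    rcases le_or_gt m ij.1 with h | h
    · rw [iterate_eq_zero_of_le D hm h]; ring
    · rw [iterate_eq_zero_of_le D hn (by omega)]; ring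
  add_mem' := by
    rintro a b ⟨m, hm⟩ ⟨n, hn⟩
    refine ⟨m + n, ?_⟩
    rw [iterate_map_add, iterate_eq_zero_of_le D hm (by omega),
      iterate_eq_zero_of_le D hn (by omega), add_zero]
  algebraMap_mem' r := ⟨1, by simp⟩

theorem mem_nilpotentElements {a : A} : a ∈ nilpotentElements D ↔ ∃ n, (⇑D)^[n] a = 0 := Iff.rfl

theorem mem_nilpotentElements_of_map_mem {a : A} (h : D a ∈ nilpotentElements D) :
    a ∈ nilpotentElements D := by
  obtain ⟨n, hn⟩ := h
  exact ⟨n + 1, by rwa [Function.iterate_succ_apply]⟩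

variable {D}

/-- The order of nilpotency of a nonzero element: the largest `n` with `Dⁿ a ≠ 0`. -/
theorem IsLocallyNilpotent.exists_order (hD : IsLocallyNilpotent D) {a : A} (ha : a ≠ 0) :
    ∃ n, (⇑D)^[n] a ≠ 0 ∧ (⇑D)^[n + 1] a = 0 := by
  classical
  obtain ⟨n, hn⟩ : ∃ n, Nat.find (hD a) = n + 1 := by
    refine Nat.exists_eq_succ_of_ne_zero fun h => ha ?_
    have := Nat.find_spec (hD a)
    rwa [h] at this
  exact ⟨n, Nat.find_min (hD a) (by omega), hn ▸ Nat.find_spec (hD a)⟩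

theorem iterate_mul_of_order {a b : A} {m n : ℕ} (ha : (⇑D)^[m + 1] a = 0)
    (hb : (⇑D)^[n + 1] b = 0) :
    (⇑D)^[m + n] (a * b) = ((m + n).choose m : A) * ((⇑D)^[m] a * (⇑D)^[n] b) := by
  rw [iterate_leibniz, Finset.sum_eq_single (m, n)]
  · rintro ⟨i, j⟩ hij hne
    have h := Finset.HasAntidiagonal.mem_antidiagonal.1 hij
    simp only [ne_eq, Prod.mk.injEq, not_and] at h hne ⊢
    rcases lt_trichotomy i m with h1 | h1 | h1
    · rw [iterate_eq_zero_of_le D hb (by omega)]; ring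
    · exact absurd (by omega) (hne h1)
    · rw [iterate_eq_zero_of_le D ha (by omega)]; ring
  · intro h
    simp at h

variable [IsDomain A] [CharZero A]

/-- Orders of nilpotency add under multiplication, like degrees: a single Leibniz term survives, and
its binomial coefficient is nonzero in characteristic zero. -/
theorem iterate_mul_ne_zero {a b : A} {m n : ℕ} (ha : (⇑D)^[m] a ≠ 0) (hb : (⇑D)^[n] b ≠ 0)
    (ha' : (⇑D)^[m + 1] a = 0) (hb' : (⇑D)^[n + 1] b = 0) : (⇑D)^[m + n] (a * b) ≠ 0 := by
  rw [iterate_mul_of_order ha' hb']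
  exact mul_ne_zero (Nat.cast_ne_zero.2 (Nat.choose_pos (by omega)).ne') (mul_ne_zero ha hb)

/-- The kernel of a locally nilpotent derivation is factorially closed. -/
theorem IsLocallyNilpotent.map_eq_zero_of_dvd (hD : IsLocallyNilpotent D) {a b : A} (hb : b ≠ 0)
    (hDb : D b = 0) (h : a ∣ b) : D a = 0 := by
  obtain ⟨c, rfl⟩ := h
  obtain ⟨m, hm, hm'⟩ := hD.exists_order (left_ne_zero_of_mul hb)
  obtain ⟨n, hn, hn'⟩ := hD.exists_order (right_ne_zero_of_mul hb)
  -- The product has order `0`, so both factors have order `0`.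
  have h1 := iterate_mul_ne_zero hm hn hm' hn'
  have h2 : m + n = 0 := by
    by_contra h0
    exact h1 (iterate_eq_zero_of_le D (m := 1) hDb (by omega))
  obtain rfl : m = 0 := by omega
  exact hm'

/-- By additivity the order of a divisor of `D x` is at most that of `D x`, and applying `D` lowers
the order by one. -/
theorem IsLocallyNilpotent.order_lt (hD : IsLocallyNilpotent D) {x y : A} {m n : ℕ}
    (h : y ∣ D x) (hx : D x ≠ 0) (hm : (⇑D)^[m + 1] x = 0) (hn : (⇑D)^[n] y ≠ 0)
    (hn' : (⇑D)^[n + 1] y = 0) : n < m := by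
  obtain ⟨u, hu⟩ := h
  obtain ⟨k, hk, hk'⟩ := hD.exists_order (right_ne_zero_of_mul (hu ▸ hx))
  have h1 := iterate_mul_ne_zero hn hk hn' hk'
  by_contra! hlt
  rw [← hu, ← Function.iterate_succ_apply] at h1
  exact h1 (iterate_eq_zero_of_le D hm (by omega))

theorem IsLocallyNilpotent.map_eq_zero_of_dvd_of_dvd (hD : IsLocallyNilpotent D) {x y : A}
    (hxy : y ∣ D x) (hyx : x ∣ D y) : D x = 0 ∨ D y = 0 := by
  by_contra! h
  obtain ⟨m, hm, hm'⟩ := hD.exists_order (a := x) (by rintro rfl; simp at h)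
  obtain ⟨n, hn, hn'⟩ := hD.exists_order (a := y) (by rintro rfl; simp at h)
  have h1 := hD.order_lt hxy h.1 hm' hn hn'
  have h2 := hD.order_lt hyx h.2 hn' hm hm'
  omega

end Nilpotent

/-! ### The Jacobian derivation and leading forms -/

/-- The derivation `h ↦ ∂₀f ∂₁h - ∂₁f ∂₀h` of `ℂ[z₀, z₁]`. -/
def jac (f : MvPolynomial (Fin 2) ℂ) :
    Derivation ℂ (MvPolynomial (Fin 2) ℂ) (MvPolynomial (Fin 2) ℂ) :=
  pderiv 0 f • pderiv 1 - pderiv 1 f • pderiv 0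

theorem jac_apply (f h : MvPolynomial (Fin 2) ℂ) :
    jac f h = pderiv 0 f * pderiv 1 h - pderiv 1 f * pderiv 0 h := by
  simp [jac]

theorem jac_X_zero (f : MvPolynomial (Fin 2) ℂ) : jac f (X 0) = -pderiv 1 f := by
  simp [jac_apply, pderiv_X]

theorem jac_X_one (f : MvPolynomial (Fin 2) ℂ) : jac f (X 1) = pderiv 0 f := by
  simp [jac_apply, pderiv_X]

theorem jac_self (f : MvPolynomial (Fin 2) ℂ) : jac f f = 0 := by
  rw [jac_apply]; ring

theorem jac_isLocallyNilpotent {f : MvPolynomial (Fin 2) ℂ}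
    (h : ∀ i, ∃ n, (jac f)^[n] (X i) = 0) : IsLocallyNilpotent (jac f) := by
  have h1 : nilpotentElements (jac f) = ⊤ := by
    rw [← top_le_iff, ← MvPolynomial.adjoin_range_X, Algebra.adjoin_le_iff]
    rintro _ ⟨i, rfl⟩
    exact h i
  intro a
  rw [← mem_nilpotentElements, h1]
  trivial

/-- The polynomials all of whose monomials have weight less than `N`. -/
def weightLT {σ : Type*} (w : σ → ℤ) (N : ℤ) : Submodule ℂ (MvPolynomial σ ℂ) :=
  restrictSupport ℂ {d | Finsupp.weight w d < N}

theorem mem_weightLT {σ : Type*} {w : σ → ℤ} {N : ℤ} {f : MvPolynomial σ ℂ} :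
    f ∈ weightLT w N ↔ ∀ d, coeff d f ≠ 0 → Finsupp.weight w d < N := by
  simp only [weightLT, mem_restrictSupport_iff, Set.subset_def, Finset.mem_coe, mem_support_iff,
    Set.mem_ofPred_eq]

/-- Weights are integers, so the sum is at most `M + N - 2`. The resulting slack of one is what
allows a factor of weight exactly `M`, which lies only in `weightLT w (M + 1)`. -/
theorem mul_mem_weightLT {σ : Type*} {w : σ → ℤ} {M N K : ℤ} {f g : MvPolynomial σ ℂ}
    (hf : f ∈ weightLT w M) (hg : g ∈ weightLT w N) (hK : M + N ≤ K + 1) :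
    f * g ∈ weightLT w K := by
  classical
  rw [mem_weightLT] at *
  intro d hd
  rw [coeff_mul] at hd
  obtain ⟨⟨a, b⟩, hab, h⟩ := Finset.exists_ne_zero_of_sum_ne_zero hd
  have h1 := hf a (left_ne_zero_of_mul h)
  have h2 := hg b (right_ne_zero_of_mul h)
  rw [← Finset.HasAntidiagonal.mem_antidiagonal.1 hab, map_add]
  dsimp only at h1 h2 ⊢
  omega

theorem pderiv_mem_weightLT {σ : Type*} {w : σ → ℤ} {N : ℤ} {f : MvPolynomial σ ℂ}
    (hf : f ∈ weightLT w N) (i : σ) : pderiv i f ∈ weightLT w (N - w i) := by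
  rw [mem_weightLT] at *
  intro d hd
  rw [coeff_pderiv] at hd
  have h := hf _ (left_ne_zero_of_mul hd)
  rw [map_add, Finsupp.weight_single, one_smul] at h
  omega

theorem _root_.MvPolynomial.IsWeightedHomogeneous.mem_weightLT {σ : Type*} {w : σ → ℤ} {M N : ℤ}
    {f : MvPolynomial σ ℂ} (hf : f.IsWeightedHomogeneous w M) (hMN : M < N) :
    f ∈ weightLT w N := by
  rw [ContactAut.mem_weightLT]
  intro d hd
  rw [hf hd]
  exact hMN

theorem _root_.MvPolynomial.IsWeightedHomogeneous.eq_zero_of_mem_weightLT {σ : Type*} {w : σ → ℤ}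
    {N : ℤ} {f : MvPolynomial σ ℂ} (hf : f.IsWeightedHomogeneous w N) (h : f ∈ weightLT w N) :
    f = 0 := by
  rw [ContactAut.mem_weightLT] at h
  ext d
  by_contra hd
  exact (h d hd).ne (hf hd)

theorem jac_mem_weightLT {w : Fin 2 → ℤ} {M N K : ℤ} {f h : MvPolynomial (Fin 2) ℂ}
    (hf : f ∈ weightLT w M) (hh : h ∈ weightLT w N) (hK : M + N - w 0 - w 1 ≤ K + 1) :
    jac f h ∈ weightLT w K := by
  rw [jac_apply]
  exact sub_mem
    (mul_mem_weightLT (pderiv_mem_weightLT hf 0) (pderiv_mem_weightLT hh 1) (by omega))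
    (mul_mem_weightLT (pderiv_mem_weightLT hf 1) (pderiv_mem_weightLT hh 0) (by omega))

theorem jac_isWeightedHomogeneous {w : Fin 2 → ℤ} {M N : ℤ} {f h : MvPolynomial (Fin 2) ℂ}
    (hf : f.IsWeightedHomogeneous w M) (hh : h.IsWeightedHomogeneous w N) :
    (jac f h).IsWeightedHomogeneous w (N + (M - w 0 - w 1)) := by
  have e (F : MvPolynomial (Fin 2) ℂ) (K : ℤ) (hF : F.IsWeightedHomogeneous w K) (i : Fin 2) :
      (pderiv i F).IsWeightedHomogeneous w (K - w i) := hF.pderiv (by ring)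
  rw [jac_apply]
  refine IsWeightedHomogeneous.sub ?_ ?_
  · rw [show N + (M - w 0 - w 1) = M - w 0 + (N - w 1) by ring]
    exact (e f M hf 0).mul (e h N hh 1)
  · rw [show N + (M - w 0 - w 1) = M - w 1 + (N - w 0) by ring]
    exact (e f M hf 1).mul (e h N hh 0)

/-- The leading form of a locally nilpotent Jacobian derivation is locally nilpotent. -/
theorem IsLocallyNilpotent.jac_leadingForm {w : Fin 2 → ℤ} {N : ℤ} {f f₀ : MvPolynomial (Fin 2) ℂ}
    (hD : IsLocallyNilpotent (jac f)) (hf₀ : f₀.IsWeightedHomogeneous w N)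
    (hf : f - f₀ ∈ weightLT w N) : IsLocallyNilpotent (jac f₀) := by
  refine jac_isLocallyNilpotent fun i => ?_
  obtain ⟨n, hn⟩ := hD (X i)
  -- `jac f₀` shifts weights by `N - w 0 - w 1`, while `jac (f - f₀)` shifts them by strictly less;
  -- so the iterates of `jac f₀` are the leading forms of those of `jac f`. Once the latter vanish,
  -- the former are homogeneous of a weight they must stay below, hence zero.
  have key : ∀ k : ℕ,
      ((jac f₀)^[k] (X i)).IsWeightedHomogeneous w (w i + k * (N - w 0 - w 1)) ∧
      (jac f)^[k] (X i) - (jac f₀)^[k] (X i) ∈ weightLT w (w i + k * (N - w 0 - w 1)) := by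
    intro k
    induction k with
    | zero => simpa using isWeightedHomogeneous_X ℂ w i
    | succ k ih =>
      obtain ⟨h1, h2⟩ := ih
      simp only [Function.iterate_succ_apply']
      set a := (jac f₀)^[k] (X i)
      set b := (jac f)^[k] (X i)
      push_cast
      set e : ℤ := w i + k * (N - w 0 - w 1) with he
      have he' : w i + ((k : ℤ) + 1) * (N - w 0 - w 1) = e + (N - w 0 - w 1) := by rw [he]; ring
      rw [he']
      refine ⟨jac_isWeightedHomogeneous hf₀ h1, ?_⟩
      have h3 : jac f b - jac f₀ a =
          jac (f - f₀) (b - a) + jac (f - f₀) a + jac f₀ (b - a) := by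
        simp only [jac_apply, map_sub]; ring
      rw [h3]
      exact add_mem (add_mem (jac_mem_weightLT hf h2 (by omega))
        (jac_mem_weightLT hf (h1.mem_weightLT (lt_add_one _)) (by omega)))
        (jac_mem_weightLT (hf₀.mem_weightLT (lt_add_one _)) h2 (by omega))
  obtain ⟨h1, h2⟩ := key n
  refine ⟨n, h1.eq_zero_of_mem_weightLT ?_⟩
  rw [hn, zero_sub] at h2
  exact neg_mem_iff.1 h2

/-! ### Lowering the degree of a polynomial whose Jacobian derivation is locally nilpotent -/

theorem weight_fin_two {i j : Fin 2} (hij : i ≠ j) (w : Fin 2 → ℤ) (d : Fin 2 →₀ ℕ) :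
    Finsupp.weight w d = d i * w i + d j * w j := by
  rw [Finsupp.weight_apply, Finsupp.sum_fintype _ _ (by simp), Fin.sum_univ_two]
  simp only [nsmul_eq_mul]
  fin_cases i <;> fin_cases j <;> simp_all [add_comm]

theorem X_dvd_of_coeff {σ : Type*} {i : σ} {f : MvPolynomial σ ℂ}
    (h : ∀ d, coeff d f ≠ 0 → d i ≠ 0) : X i ∣ f := by
  rw [f.as_sum]
  refine Finset.dvd_sum fun d hd => ?_
  rw [X_dvd_monomial]
  exact Or.inr (h d (mem_support_iff.1 hd))

theorem ne_zero_of_X_dvd {σ : Type*} {i : σ} {f : MvPolynomial σ ℂ} (h : X i ∣ f)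
    {d : σ →₀ ℕ} (hd : coeff d f ≠ 0) : d i ≠ 0 := by
  classical
  obtain ⟨g, rfl⟩ := h
  intro h0
  rw [mul_comm, coeff_mul_X'] at hd
  simp [h0] at hd

theorem coeff_eq_zero_of_pderiv_eq_zero {σ : Type*} {i : σ} {f : MvPolynomial σ ℂ}
    (h : pderiv i f = 0) {d : σ →₀ ℕ} (hd : d i ≠ 0) : coeff d f = 0 := by
  have h1 := coeff_pderiv (i := i) f (d - Finsupp.single i 1)
  have h2 : d - Finsupp.single i 1 + Finsupp.single i 1 = d :=
    tsub_add_cancel_of_le (Finsupp.single_le_iff.2 (Nat.one_le_iff_ne_zero.2 hd))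
  rw [h, h2, coeff_zero, eq_comm, mul_eq_zero] at h1
  exact h1.resolve_right (Nat.cast_add_one_ne_zero _)

theorem jac_X_eq_zero_iff {i j : Fin 2} (hij : i ≠ j) {f : MvPolynomial (Fin 2) ℂ} :
    jac f (X i) = 0 ↔ pderiv j f = 0 := by
  fin_cases i <;> fin_cases j <;> simp_all [jac_X_zero, jac_X_one]

theorem sub_weightedHomogeneousComponent_mem {σ : Type*} {w : σ → ℤ} {N : ℤ}
    {f : MvPolynomial σ ℂ} (h : ∀ d, coeff d f ≠ 0 → Finsupp.weight w d ≤ N) :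
    f - weightedHomogeneousComponent w N f ∈ weightLT w N := by
  rw [mem_weightLT]
  intro d hd
  rw [coeff_sub, coeff_weightedHomogeneousComponent] at hd
  split_ifs at hd with h1
  · simp at hd
  · exact lt_of_le_of_ne (h d (by simpa using hd)) h1

theorem le_degreeOf {σ : Type*} {f : MvPolynomial σ ℂ} {d : σ →₀ ℕ} (hd : coeff d f ≠ 0) (i : σ) :
    d i ≤ degreeOf i f :=
  degreeOf_le_iff.1 le_rfl d (mem_support_iff.2 hd)

/-- The only monomial of maximal degree in a variable is a power of that variable. -/
theorem IsLocallyNilpotent.eq_zero_of_eq_degreeOf {f : MvPolynomial (Fin 2) ℂ}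
    (hD : IsLocallyNilpotent (jac f)) {i j : Fin 2} (hij : i ≠ j) (hi : degreeOf i f ≠ 0)
    {d : Fin 2 →₀ ℕ} (hd : coeff d f ≠ 0) (hdi : d i = degreeOf i f) : d j = 0 := by
  -- For this weight the leading form is the part of top degree in `z_i`.
  set w : Fin 2 → ℤ := Pi.single i 1
  have hw (e : Fin 2 →₀ ℕ) : Finsupp.weight w e = e i := by
    rw [weight_fin_two hij]
    simp [w, hij.symm]
  set f₀ := weightedHomogeneousComponent w (degreeOf i f : ℤ) f with hf₀
  have hcoeff (e : Fin 2 →₀ ℕ) : coeff e f₀ = if e i = degreeOf i f then coeff e f else 0 := by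
    rw [hf₀, coeff_weightedHomogeneousComponent, hw]
    simp only [Nat.cast_inj]
  have hD₀ : IsLocallyNilpotent (jac f₀) :=
    hD.jac_leadingForm (weightedHomogeneousComponent_isWeightedHomogeneous _ _)
      (sub_weightedHomogeneousComponent_mem fun e he => by
        rw [hw]; exact_mod_cast le_degreeOf he i)
  have hne : coeff d f₀ ≠ 0 := by rwa [hcoeff, if_pos hdi]
  -- `f₀` lies in the kernel of its own derivation and `z_i` divides it; by factorial closure `z_i`
  -- is in the kernel, so `f₀` does not involve `z_j`.
  have hker : jac f₀ (X i) = 0 := by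
    refine hD₀.map_eq_zero_of_dvd (b := f₀) (by rintro h; simp [h] at hne) (jac_self _)
      (X_dvd_of_coeff fun e he => ?_)
    rw [hcoeff] at he
    have := (ite_ne_right_iff.1 he).1
    omega
  by_contra hdj
  exact hne (coeff_eq_zero_of_pderiv_eq_zero ((jac_X_eq_zero_iff hij).1 hker) hdj)

theorem exists_eq_degreeOf {σ : Type*} {f : MvPolynomial σ ℂ} {i : σ} (hi : degreeOf i f ≠ 0) :
    ∃ d, coeff d f ≠ 0 ∧ d i = degreeOf i f := by
  by_contra! h
  have h1 : degreeOf i f ≤ degreeOf i f - 1 := by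
    refine degreeOf_le_iff.2 fun d hd => ?_
    have h2 := h d (mem_support_iff.1 hd)
    have h3 := le_degreeOf (mem_support_iff.1 hd) i
    omega
  omega

/-- This puts a corner of the Newton polygon on each axis. -/
theorem IsLocallyNilpotent.coeff_single_degreeOf_ne_zero {f : MvPolynomial (Fin 2) ℂ}
    (hD : IsLocallyNilpotent (jac f)) {i : Fin 2} (hi : degreeOf i f ≠ 0) :
    coeff (Finsupp.single i (degreeOf i f)) f ≠ 0 := by
  obtain ⟨d, hd, hdi⟩ := exists_eq_degreeOf hi
  convert! hd using 2
  ext j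
  rcases eq_or_ne i j with rfl | hij
  · simp [hdi]
  · rw [Finsupp.single_eq_of_ne hij.symm, hD.eq_zero_of_eq_degreeOf hij hi hd hdi]

theorem coeff_eq_zero_of_jac_X_eq_zero {f : MvPolynomial (Fin 2) ℂ} (h : ∀ i, jac f (X i) = 0)
    {d : Fin 2 →₀ ℕ} (hd : d ≠ 0) : coeff d f = 0 := by
  obtain ⟨i, hi⟩ := Finsupp.ne_iff.1 hd
  refine coeff_eq_zero_of_pderiv_eq_zero (i := i) ?_ hi
  obtain ⟨j, hj⟩ := exists_ne i
  exact (jac_X_eq_zero_iff hj).1 (h j)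

/-- The weights that are proportional to the inverses of the degrees in the two variables. -/
def degreeWeight (f : MvPolynomial (Fin 2) ℂ) : Fin 2 → ℤ := ![degreeOf 1 f, degreeOf 0 f]

theorem weight_degreeWeight (f : MvPolynomial (Fin 2) ℂ) (d : Fin 2 →₀ ℕ) :
    Finsupp.weight (degreeWeight f) d = d 0 * degreeOf 1 f + d 1 * degreeOf 0 f :=
  weight_fin_two (by decide) _ _

/-- The Newton polygon is a triangle. -/
theorem IsLocallyNilpotent.weight_le {f : MvPolynomial (Fin 2) ℂ}
    (hD : IsLocallyNilpotent (jac f)) (h0 : degreeOf 0 f ≠ 0) (h1 : degreeOf 1 f ≠ 0)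
    {d : Fin 2 →₀ ℕ} (hd : coeff d f ≠ 0) :
    Finsupp.weight (degreeWeight f) d ≤ degreeOf 0 f * degreeOf 1 f := by
  set w := degreeWeight f with hw
  obtain ⟨e, he, hmax⟩ := Finset.exists_max_image f.support (fun d => Finsupp.weight w d)
    ⟨d, mem_support_iff.2 hd⟩
  refine (hmax d (mem_support_iff.2 hd)).trans ?_
  by_contra! hlt
  set N := Finsupp.weight w e with hN
  set f₀ := weightedHomogeneousComponent w N f with hf₀
  have hcoeff (d : Fin 2 →₀ ℕ) : coeff d f₀ = if Finsupp.weight w d = N then coeff d f else 0 :=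
    coeff_weightedHomogeneousComponent _ _ _
  have hD₀ : IsLocallyNilpotent (jac f₀) :=
    hD.jac_leadingForm (weightedHomogeneousComponent_isWeightedHomogeneous _ _)
      (sub_weightedHomogeneousComponent_mem fun e he => hmax e (mem_support_iff.2 he))
  have hne : coeff e f₀ ≠ 0 := by rw [hcoeff, if_pos rfl]; exact mem_support_iff.1 he
  -- A monomial lacking one variable has weight at most `degreeOf 0 f * degreeOf 1 f`, so none
  -- occurs in `f₀`. Both variables then divide `f₀` and lie in the kernel, which makes `f₀`
  -- constant, of weight `0`.
  have hdvd (i : Fin 2) : X i ∣ f₀ := by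
    refine X_dvd_of_coeff fun d hd h => ?_
    rw [hcoeff] at hd
    obtain ⟨hdN, hd⟩ := ite_ne_right_iff.1 hd
    rw [← hdN, hw, weight_degreeWeight] at hlt
    have l0 := le_degreeOf hd 0
    have l1 := le_degreeOf hd 1
    norm_cast at hlt
    fin_cases i
    · simp only [Fin.zero_eta] at h
      rw [h] at hlt
      nlinarith
    · simp only [Fin.mk_one] at h
      rw [h] at hlt
      nlinarith
  have hf₀0 : f₀ ≠ 0 := by rintro h; simp [h] at hne
  refine hne (coeff_eq_zero_of_jac_X_eq_zero
    (fun i => hD₀.map_eq_zero_of_dvd hf₀0 (jac_self _) (hdvd i)) ?_)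
  rintro rfl
  rw [hN, map_zero] at hlt
  have : (0 : ℤ) ≤ degreeOf 0 f * degreeOf 1 f := by positivity
  omega

/-- The part of a polynomial on the edge of its Newton triangle. -/
def edgePart (f : MvPolynomial (Fin 2) ℂ) : MvPolynomial (Fin 2) ℂ :=
  weightedHomogeneousComponent (degreeWeight f) (degreeOf 0 f * degreeOf 1 f) f

theorem coeff_edgePart (f : MvPolynomial (Fin 2) ℂ) (d : Fin 2 →₀ ℕ) :
    coeff d (edgePart f) =
      if d 0 * degreeOf 1 f + d 1 * degreeOf 0 f = degreeOf 0 f * degreeOf 1 f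
        then coeff d f else 0 := by
  rw [edgePart, coeff_weightedHomogeneousComponent, weight_degreeWeight]
  norm_cast

theorem IsLocallyNilpotent.jac_edgePart {f : MvPolynomial (Fin 2) ℂ}
    (hD : IsLocallyNilpotent (jac f)) (h0 : degreeOf 0 f ≠ 0) (h1 : degreeOf 1 f ≠ 0) :
    IsLocallyNilpotent (jac (edgePart f)) :=
  hD.jac_leadingForm (weightedHomogeneousComponent_isWeightedHomogeneous _ _)
    (sub_weightedHomogeneousComponent_mem fun _ hd => hD.weight_le h0 h1 hd)

theorem IsLocallyNilpotent.coeff_edgePart_single_ne_zero {f : MvPolynomial (Fin 2) ℂ}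
    (hD : IsLocallyNilpotent (jac f)) {i : Fin 2} (hi : degreeOf i f ≠ 0) :
    coeff (Finsupp.single i (degreeOf i f)) (edgePart f) ≠ 0 := by
  rw [coeff_edgePart, if_pos]
  · exact hD.coeff_single_degreeOf_ne_zero hi
  · fin_cases i <;> simp [mul_comm]

theorem monomial_fin_two (d : Fin 2 →₀ ℕ) (a : ℂ) :
    monomial d a = C a * (X 0 ^ d 0 * X 1 ^ d 1) := by
  rw [monomial_eq, Finsupp.prod_fintype _ _ (by simp), Fin.prod_univ_two]

/-- The edge part has a quasi-homogeneous binomial factor. -/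
theorem IsLocallyNilpotent.exists_binomial_dvd {f : MvPolynomial (Fin 2) ℂ}
    (hD : IsLocallyNilpotent (jac f)) (h0 : degreeOf 0 f ≠ 0) (h1 : degreeOf 1 f ≠ 0)
    {g p q : ℕ} (hp : degreeOf 0 f = g * p) (hq : degreeOf 1 f = g * q) (hpq : Nat.Coprime p q) :
    ∃ c : ℂ, c ≠ 0 ∧ X 1 ^ q - C c * X 0 ^ p ∣ edgePart f := by
  have hg : g ≠ 0 := by rintro rfl; simp at hp; exact h0 hp
  have hq0 : q ≠ 0 := by rintro rfl; simp at hq; exact h1 hq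
  have hp0 : p ≠ 0 := by rintro rfl; simp at hp; exact h0 hp
  -- Divided by `g`, the edge equation reads `d₀ q + d₁ p = g p q`. By coprimality, edge monomials
  -- are products `(z₀^p)^l (z₁^q)^k` with `k + l = g`.
  have hsupp : ∀ d ∈ (edgePart f).support, ∃ k l, d 0 = p * l ∧ d 1 = q * k ∧ k + l = g := by
    intro d hd
    rw [mem_support_iff, coeff_edgePart] at hd
    have h := (ite_ne_right_iff.1 hd).1
    have h2 : d 0 * q + d 1 * p = g * p * q := by
      rw [hp, hq] at h
      exact Nat.eq_of_mul_eq_mul_left (Nat.pos_of_ne_zero hg) (by linarith)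
    obtain ⟨l, hl⟩ : p ∣ d 0 := by
      refine hpq.dvd_of_dvd_mul_right ((Nat.dvd_add_left (dvd_mul_left p (d 1))).1 ?_)
      rw [h2]
      exact ⟨g * q, by ring⟩
    obtain ⟨k, hk⟩ : q ∣ d 1 := by
      refine hpq.symm.dvd_of_dvd_mul_right ((Nat.dvd_add_right (dvd_mul_left q (d 0))).1 ?_)
      rw [h2]
      exact ⟨g * p, by ring⟩
    refine ⟨k, l, hl, hk, ?_⟩
    rw [hl, hk] at h2
    have hpos : 0 < p * q := Nat.pos_of_ne_zero (mul_ne_zero hp0 hq0)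
    exact Nat.eq_of_mul_eq_mul_left hpos (by linarith)
  -- The edge part dehomogenized by `z₀^p = 1`, `z₁^q = T`. The pure power of `z₁` gives the nonzero
  -- coefficient of `T^g`, so `P` has a root `c`.
  set P : Polynomial ℂ :=
    ∑ d ∈ (edgePart f).support, Polynomial.monomial (d 1 / q) (coeff d (edgePart f)) with hP
  have hPg : P.coeff g ≠ 0 := by
    rw [hP, Polynomial.finsetSum_coeff, Finset.sum_eq_single (Finsupp.single 1 (degreeOf 1 f))]
    · rw [Polynomial.coeff_monomial, if_pos]
      · exact hD.coeff_edgePart_single_ne_zero h1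
      · rw [Finsupp.single_eq_same, hq, Nat.mul_div_cancel _ (Nat.pos_of_ne_zero hq0)]
    · intro d hd hne
      rw [Polynomial.coeff_monomial, if_neg]
      obtain ⟨k, l, hl, hk, hkl⟩ := hsupp d hd
      rw [hk, Nat.mul_div_cancel_left _ (Nat.pos_of_ne_zero hq0)]
      rintro rfl
      refine hne (Finsupp.ext fun i => ?_)
      fin_cases i
      · simp [hl]; omega
      · simp [hk, hq, mul_comm]
    · intro h
      exact absurd (mem_support_iff.2 (hD.coeff_edgePart_single_ne_zero h1)) h
  obtain ⟨c, hc⟩ := IsAlgClosed.exists_root P (by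
    intro h
    have := Polynomial.coeff_eq_zero_of_degree_lt (p := P) (n := g)
      (by rw [h]; exact_mod_cast Nat.pos_of_ne_zero hg)
    exact hPg this)
  have hdvd : X 1 ^ q - C c * X 0 ^ p ∣ edgePart f := by
    -- The subtracted terms sum to `z₀^(g p) P(c) = 0`; after this subtraction each summand is
    -- divisible by the binomial.
    have h2 : edgePart f = ∑ d ∈ (edgePart f).support, C (coeff d (edgePart f)) *
        (X 0 ^ d 0 * X 1 ^ d 1 - X 0 ^ degreeOf 0 f * C c ^ (d 1 / q)) := by
      simp only [mul_sub, Finset.sum_sub_distrib, ← monomial_fin_two]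
      rw [← (edgePart f).as_sum, eq_comm, sub_eq_self]
      rw [Polynomial.IsRoot, hP, Polynomial.eval_finsetSum] at hc
      simp only [Polynomial.eval_monomial] at hc
      calc ∑ d ∈ (edgePart f).support, C (coeff d (edgePart f)) *
            (X 0 ^ degreeOf 0 f * C c ^ (d 1 / q)) = (X 0 : MvPolynomial (Fin 2) ℂ) ^ degreeOf 0 f *
            C (∑ d ∈ (edgePart f).support, coeff d (edgePart f) * c ^ (d 1 / q)) := by
            rw [map_sum, Finset.mul_sum]
            refine Finset.sum_congr rfl fun d _ => ?_
            rw [map_mul, map_pow]; ring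
        _ = 0 := by rw [hc, map_zero, mul_zero]
    rw [h2]
    refine Finset.dvd_sum fun d hd => Dvd.dvd.mul_left ?_ _
    obtain ⟨k, l, hl, hk, hkl⟩ := hsupp d hd
    rw [hk, Nat.mul_div_cancel_left _ (Nat.pos_of_ne_zero hq0), hl, hp, ← hkl]
    have h3 : (X 0 ^ (p * l) * X 1 ^ (q * k) - X 0 ^ ((k + l) * p) * C c ^ k :
        MvPolynomial (Fin 2) ℂ) =
        X 0 ^ (p * l) * ((X 1 ^ q) ^ k - (C c * X 0 ^ p) ^ k) := by
      ring
    rw [h3]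
    exact (sub_dvd_pow_sub_pow _ _ k).mul_left _
  refine ⟨c, ?_, hdvd⟩
  rintro rfl
  -- With `c = 0` the edge part would be divisible by `z₁`, yet it contains a pure power of `z₀`.
  rw [map_zero, zero_mul, sub_zero] at hdvd
  refine ne_zero_of_X_dvd ((dvd_pow_self (X 1) hq0).trans hdvd)
    (hD.coeff_edgePart_single_ne_zero h0) ?_
  simp

theorem X_dvd_of_dvd_smul_pow_mul {i j : Fin 2} (hij : i ≠ j) {a : ℂ} (ha : a ≠ 0) {k : ℕ}
    {h : MvPolynomial (Fin 2) ℂ} (hdvd : X i ∣ C a * (X j ^ k * h)) : X i ∣ h := by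
  have hX : Prime (X i : MvPolynomial (Fin 2) ℂ) := X_prime
  rcases hX.dvd_or_dvd hdvd with h1 | h1
  · exact absurd (isUnit_of_dvd_unit h1 ((isUnit_iff_ne_zero.2 ha).map C)) hX.not_isUnit
  · rcases hX.dvd_or_dvd h1 with h2 | h2
    · exact absurd (X_dvd_X.1 (hX.dvd_of_dvd_pow h2)) (by simpa using hij)
    · exact h2

/-- A binomial in the kernel of a nonzero locally nilpotent derivation is linear in one of the
variables. -/
theorem IsLocallyNilpotent.eq_one_or_eq_one {f : MvPolynomial (Fin 2) ℂ}
    (hD : IsLocallyNilpotent (jac f)) {p q : ℕ} (hp : p ≠ 0) (hq : q ≠ 0) {c : ℂ} (hc : c ≠ 0)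
    (hker : jac f (X 1 ^ q - C c * X 0 ^ p) = 0) (hne : ∃ d ≠ 0, coeff d f ≠ 0) :
    p = 1 ∨ q = 1 := by
  obtain ⟨d, hd0, hd⟩ := hne
  have hk : C (q : ℂ) * (X 1 ^ (q - 1) * jac f (X 1)) =
      C (c * p) * (X 0 ^ (p - 1) * jac f (X 0)) := by
    have h1 : jac f (C c * X 0 ^ p) = C c * jac f (X 0 ^ p) := by
      rw [← smul_eq_C_mul, Derivation.map_smul, smul_eq_C_mul]
    rw [map_sub, h1, Derivation.leibniz_pow, Derivation.leibniz_pow, sub_eq_zero] at hker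
    simp only [nsmul_eq_mul, smul_eq_mul] at hker
    rw [map_natCast, map_mul, map_natCast, hker]
    ring
  have hq' : (q : ℂ) ≠ 0 := Nat.cast_ne_zero.2 hq
  have hp' : c * p ≠ 0 := mul_ne_zero hc (Nat.cast_ne_zero.2 hp)
  -- If `p, q ≥ 2`, the relation `hk` shows that `z₁` divides `D z₀` and `z₀` divides `D z₁`.
  -- Comparing orders kills one of these derivatives, `hk` kills the other, and `f` would be
  -- constant.
  by_contra! h
  have h01 : (X 1 : MvPolynomial (Fin 2) ℂ) ∣ jac f (X 0) := by
    refine X_dvd_of_dvd_smul_pow_mul (j := 0) (by decide) hp' (k := p - 1) ?_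
    rw [← hk]
    exact ((dvd_pow_self _ (by omega)).mul_right _).mul_left _
  have h10 : (X 0 : MvPolynomial (Fin 2) ℂ) ∣ jac f (X 1) := by
    refine X_dvd_of_dvd_smul_pow_mul (j := 1) (by decide) hq' (k := q - 1) ?_
    rw [hk]
    exact ((dvd_pow_self _ (by omega)).mul_right _).mul_left _
  have hiff : jac f (X 0) = 0 ↔ jac f (X 1) = 0 := by
    have e (a : ℂ) (ha : a ≠ 0) (i : Fin 2) (k : ℕ) (F : MvPolynomial (Fin 2) ℂ) :
        C a * (X i ^ k * F) = 0 ↔ F = 0 := by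
      simp [ha]
    rw [← e _ hq' 1 (q - 1) (jac f (X 1)), hk, e _ hp' 0 (p - 1)]
  refine hd (coeff_eq_zero_of_jac_X_eq_zero (fun i => ?_) hd0)
  have h2 := hD.map_eq_zero_of_dvd_of_dvd h01 h10
  fin_cases i
  · exact h2.elim id hiff.2
  · exact h2.elim hiff.1 id

/-- The substitution `z_j ↦ z_j + c z_i^p`. -/
def shear (i j : Fin 2) (c : ℂ) (p : ℕ) :
    MvPolynomial (Fin 2) ℂ →ₐ[ℂ] MvPolynomial (Fin 2) ℂ :=
  aeval (Function.update X j (X j + C c * X i ^ p))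

theorem aeval_isWeightedHomogeneous {σ : Type*} {w : σ → ℤ} {G : σ → MvPolynomial σ ℂ}
    (hG : ∀ i, (G i).IsWeightedHomogeneous w (w i)) (d : σ →₀ ℕ) (a : ℂ) :
    (aeval G (monomial d a)).IsWeightedHomogeneous w (Finsupp.weight w d) := by
  rw [aeval_monomial, Finsupp.weight_apply]
  refine IsWeightedHomogeneous.C_mul ?_ a
  exact IsWeightedHomogeneous.prod _ _ _ fun i _ => (hG i).pow (d i)

theorem aeval_mem_weightLT {σ : Type*} {w : σ → ℤ} {N : ℤ} {G : σ → MvPolynomial σ ℂ}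
    (hG : ∀ i, (G i).IsWeightedHomogeneous w (w i)) {f : MvPolynomial σ ℂ}
    (hf : f ∈ weightLT w N) : aeval G f ∈ weightLT w N := by
  rw [f.as_sum, map_sum]
  exact sum_mem fun d hd => (aeval_isWeightedHomogeneous hG d _).mem_weightLT
    (mem_weightLT.1 hf d (mem_support_iff.1 hd))

theorem _root_.MvPolynomial.IsWeightedHomogeneous.aeval {σ : Type*} {w : σ → ℤ} {N : ℤ}
    {G : σ → MvPolynomial σ ℂ}
    (hG : ∀ i, (G i).IsWeightedHomogeneous w (w i)) {f : MvPolynomial σ ℂ}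
    (hf : f.IsWeightedHomogeneous w N) : (MvPolynomial.aeval G f).IsWeightedHomogeneous w N := by
  rw [f.as_sum, map_sum]
  refine IsWeightedHomogeneous.sum _ _ _ fun d hd => ?_
  rw [← hf (mem_support_iff.1 hd)]
  exact aeval_isWeightedHomogeneous hG d _

/-- Since `m = p n`, the shear preserves weights, so no monomial rises above the edge. It sends the
factor `z_j - c z_i^p` of the edge part to `z_j`, so the corner `z_i^m` disappears. -/
theorem degreeOf_shear {i j : Fin 2} (hij : i ≠ j) {w : Fin 2 → ℤ} {m n p : ℕ} {c : ℂ}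
    {f f₀ : MvPolynomial (Fin 2) ℂ} (hm : m ≠ 0) (hi : w i = n) (hj : w j = m)
    (hp : m = p * n)
    (hf₀ : f₀.IsWeightedHomogeneous w (m * n)) (hf : f - f₀ ∈ weightLT w (m * n))
    (hdvd : X j - C c * X i ^ p ∣ f₀) :
    degreeOf i (shear i j c p f) < m ∧ degreeOf j (shear i j c p f) ≤ n := by
  have hG (k : Fin 2) : (Function.update X j (X j + C c * X i ^ p) k :
      MvPolynomial (Fin 2) ℂ).IsWeightedHomogeneous w (w k) := by
    rcases eq_or_ne k j with rfl | hk
    · rw [Function.update_self]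
      refine (isWeightedHomogeneous_X ℂ w k).add ?_
      have h := ((isWeightedHomogeneous_X ℂ w i).pow p).C_mul c
      rwa [hi, nsmul_eq_mul, ← Nat.cast_mul, ← hp, ← hj] at h
    · rw [Function.update_of_ne hk]
      exact isWeightedHomogeneous_X ℂ w k
  have h1 : (shear i j c p f₀).IsWeightedHomogeneous w (m * n) := hf₀.aeval hG
  have h2 : shear i j c p (f - f₀) ∈ weightLT w (m * n) := aeval_mem_weightLT hG hf
  have h3 : X j ∣ shear i j c p f₀ := by
    have := map_dvd (shear i j c p) hdvd
    simpa [shear, hij] using this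
  have key : ∀ d ∈ (shear i j c p f).support, d i < m ∧ d j ≤ n := by
    intro d hd
    rw [mem_support_iff, ← sub_add_cancel f f₀, map_add, coeff_add] at hd
    by_cases h0 : coeff d (shear i j c p f₀) = 0
    · rw [h0, add_zero] at hd
      have h4 := mem_weightLT.1 h2 d hd
      rw [weight_fin_two hij, hi, hj] at h4
      norm_cast at h4
      constructor <;> by_contra! h5 <;> nlinarith
    · have h4 := h1 h0
      have h5 := ne_zero_of_X_dvd h3 h0
      rw [weight_fin_two hij, hi, hj] at h4
      norm_cast at h4
      have h6 : 0 < d j * m := Nat.pos_of_ne_zero (mul_ne_zero h5 hm)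
      constructor
      · by_contra! h7; nlinarith
      · by_contra! h7; nlinarith [Nat.pos_of_ne_zero hm]
  constructor
  · rw [degreeOf_lt_iff (Nat.pos_of_ne_zero hm)]
    exact fun d hd => (key d hd).1
  · rw [degreeOf_le_iff]
    exact fun d hd => (key d hd).2

/-- If the Jacobian derivation of a polynomial that involves both variables is locally nilpotent,
then an elementary substitution lowers the degrees. -/
theorem IsLocallyNilpotent.exists_shear {f : MvPolynomial (Fin 2) ℂ}
    (hD : IsLocallyNilpotent (jac f)) (h0 : degreeOf 0 f ≠ 0) (h1 : degreeOf 1 f ≠ 0) :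
    ∃ i j : Fin 2, i ≠ j ∧ ∃ (c : ℂ) (p : ℕ),
      degreeOf i (shear i j c p f) < degreeOf i f ∧ degreeOf j (shear i j c p f) ≤ degreeOf j f := by
  obtain ⟨g, p, q, hg, hpq, hp, hq⟩ :=
    Nat.exists_coprime' (m := degreeOf 0 f) (n := degreeOf 1 f)
      (Nat.gcd_pos_of_pos_left _ (Nat.pos_of_ne_zero h0))
  rw [mul_comm] at hp hq
  have hp0 : p ≠ 0 := by rintro rfl; simp at hp; exact h0 hp
  have hq0 : q ≠ 0 := by rintro rfl; simp at hq; exact h1 hq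
  obtain ⟨c, hc, hdvd⟩ := hD.exists_binomial_dvd h0 h1 hp hq hpq
  have hD₀ := hD.jac_edgePart h0 h1
  have hne := hD.coeff_edgePart_single_ne_zero h0
  have hker := hD₀.map_eq_zero_of_dvd (b := edgePart f) (by rintro h; simp [h] at hne)
    (jac_self _) hdvd
  have hhom : (edgePart f).IsWeightedHomogeneous (degreeWeight f) (degreeOf 0 f * degreeOf 1 f) :=
    weightedHomogeneousComponent_isWeightedHomogeneous _ _
  have hlt : f - edgePart f ∈ weightLT (degreeWeight f) (degreeOf 0 f * degreeOf 1 f) :=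
    sub_weightedHomogeneousComponent_mem fun _ hd => hD.weight_le h0 h1 hd
  rcases hD₀.eq_one_or_eq_one hp0 hq0 hc hker ⟨_, by simpa using h0, hne⟩ with rfl | rfl
  -- Here `z₁^q - c z₀ = -c (z₀ - c⁻¹ z₁^q)`, so the roles of the variables are exchanged and the
  -- constant is inverted.
  · refine ⟨1, 0, by decide, c⁻¹, q, degreeOf_shear (w := degreeWeight f) (f₀ := edgePart f)
      (by decide) h1 rfl rfl (by rw [hp, hq]; ring) ?_ ?_ ?_⟩
    · rwa [mul_comm]
    · rwa [mul_comm (degreeOf 1 f : ℤ)]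
    · refine dvd_trans ⟨-C c, ?_⟩ hdvd
      have : (C c * C c⁻¹ : MvPolynomial (Fin 2) ℂ) = 1 := by
        rw [← map_mul, mul_inv_cancel₀ hc, map_one]
      linear_combination -X 1 ^ q * this
  · refine ⟨0, 1, by decide, c, p, degreeOf_shear (w := degreeWeight f) (f₀ := edgePart f)
      (by decide) h0 rfl rfl (by rw [hp, hq]; ring) hhom hlt ?_⟩
    simpa using hdvd

/-! ### Polynomial automorphisms and their coordinate polynomials -/

/-- The coordinate polynomials of a polynomial automorphism. -/
def coordPoly {n : ℕ} (φ : polyAut n) : Fin n → MvPolynomial (Fin n) ℂ := φ.2.1.choose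

theorem toMap_apply_eq_eval {n : ℕ} (φ : polyAut n) (z : Aff n) (i : Fin n) :
    toMap φ z i = eval z (coordPoly φ i) :=
  φ.2.1.choose_spec z i

theorem coordPoly_eq_iff {n : ℕ} {φ : polyAut n} {i : Fin n} {P : MvPolynomial (Fin n) ℂ} :
    coordPoly φ i = P ↔ ∀ z, toMap φ z i = eval z P := by
  simp only [toMap_apply_eq_eval]
  exact ⟨fun h z => by rw [h], fun h => MvPolynomial.funext h⟩

theorem eval_aeval_eq {n m : ℕ} (G : Fin m → MvPolynomial (Fin n) ℂ)
    (p : MvPolynomial (Fin m) ℂ) (z : Aff n) :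
    eval z (aeval G p) = eval (fun i => eval z (G i)) p := by
  induction p using MvPolynomial.induction_on with
  | C a => simp [algebraMap_eq]
  | add p q hp hq => simp only [map_add, hp, hq]
  | mul_X p i hp => simp only [map_mul, aeval_X, eval_X, hp]

theorem coordPoly_mul {n : ℕ} (φ ψ : polyAut n) (i : Fin n) :
    coordPoly (φ * ψ) i = aeval (coordPoly ψ) (coordPoly φ i) := by
  rw [coordPoly_eq_iff]
  intro z
  rw [toMap_mul, Function.comp_apply, toMap_apply_eq_eval, eval_aeval_eq]
  congr 2
  funext j
  exact toMap_apply_eq_eval ψ z j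

theorem coordPoly_one {n : ℕ} (i : Fin n) : coordPoly (1 : polyAut n) i = X i := by
  rw [coordPoly_eq_iff]
  intro z
  simp [toMap_one]

theorem polyAut_ext {n : ℕ} {φ ψ : polyAut n} (h : ∀ z, toMap φ z = toMap ψ z) : φ = ψ :=
  Subtype.ext (Equiv.ext h)

theorem toMap_apply_inv {n : ℕ} (φ : polyAut n) (z : Aff n) : toMap φ (toMap φ⁻¹ z) = z :=
  Equiv.apply_symm_apply (φ : Equiv.Perm (Aff n)) z

/-- The polynomial automorphism given by two mutually inverse polynomial maps. -/
def mkPolyAut {n : ℕ} (f g : Aff n → Aff n) (hf : IsPolyMap f) (hg : IsPolyMap g)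
    (hgf : ∀ z, g (f z) = z) (hfg : ∀ z, f (g z) = z) : polyAut n :=
  ⟨⟨f, g, hgf, hfg⟩, hf, hg⟩

theorem hasFDerivAt_eval {n : ℕ} (p : MvPolynomial (Fin n) ℂ) (z : Aff n) :
    HasFDerivAt (fun z : Aff n => eval z p)
      (∑ i, eval z (pderiv i p) • ContinuousLinearMap.proj (R := ℂ) (φ := fun _ : Fin n => ℂ) i)
      z := by
  induction p using MvPolynomial.induction_on with
  | C a =>
    simp only [eval_C]
    refine (hasFDerivAt_const (𝕜 := ℂ) a z).congr_fderiv (ContinuousLinearMap.ext fun v => ?_)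
    simp
  | add p q hp hq =>
    simp only [map_add]
    refine (hp.fun_add hq).congr_fderiv (ContinuousLinearMap.ext fun v => ?_)
    simp [add_mul, Finset.sum_add_distrib]
  | mul_X p j hp =>
    have hj : HasFDerivAt (fun z : Aff n => z j)
        (ContinuousLinearMap.proj (R := ℂ) (φ := fun _ : Fin n => ℂ) j) z :=
      (ContinuousLinearMap.proj (R := ℂ) (φ := fun _ : Fin n => ℂ) j).hasFDerivAt
    simp only [map_mul, eval_X]
    refine (hp.fun_mul hj).congr_fderiv (ContinuousLinearMap.ext fun v => ?_)
    simp only [Derivation.leibniz, pderiv_X, Pi.single_apply]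
    simp [add_mul, Finset.sum_add_distrib, Finset.mul_sum, mul_assoc, apply_ite (eval z)]

theorem fderiv_toMap {n : ℕ} (φ : polyAut n) (z v : Aff n) (k : Fin n) :
    fderiv ℂ (toMap φ) z v k = ∑ i, eval z (pderiv i (coordPoly φ k)) * v i := by
  have h : HasFDerivAt (toMap φ) (ContinuousLinearMap.pi fun k =>
      ∑ i, eval z (pderiv i (coordPoly φ k)) •
        ContinuousLinearMap.proj (R := ℂ) (φ := fun _ : Fin n => ℂ) i) z := by
    rw [hasFDerivAt_pi]
    intro k
    simp only [toMap_apply_eq_eval]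
    exact hasFDerivAt_eval _ z
  rw [h.fderiv]
  simp

/-! ### The group `Aut(ℂ²)_η` -/

theorem pullback_eta_apply (φ : polyAut 2) (z : Aff 2) (v : Fin 2 → Aff 2) :
    pullback₂ (toMap φ) eta z v =
      eval z (jac (coordPoly φ 0) (coordPoly φ 1)) * (v 0 0 * v 1 1 - v 1 0 * v 0 1) := by
  have h : pullback₂ (toMap φ) eta z v =
      wedgeLin (dz 0 (toMap φ z)) (dz 1 (toMap φ z)) (fun i => fderiv ℂ (toMap φ) z (v i)) := rfl
  rw [h, wedgeLin_apply, jac_apply]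
  simp only [dz, ContinuousLinearMap.proj_apply, fderiv_toMap, Fin.sum_univ_two, map_sub, map_mul]
  ring

theorem eta_apply (z : Aff 2) (v : Fin 2 → Aff 2) : eta z v = v 0 0 * v 1 1 - v 1 0 * v 0 1 :=
  wedgeLin_apply _ _ _

theorem mem_autEta_iff {φ : polyAut 2} :
    φ ∈ AutEta ↔ jac (coordPoly φ 0) (coordPoly φ 1) = 1 := by
  change pullback₂ (toMap φ) eta = eta ↔ _
  constructor
  · intro h
    refine MvPolynomial.funext fun z => ?_
    have h1 := DFunLike.congr_fun (congrFun h z) ![![1, 0], ![0, 1]]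
    rw [pullback_eta_apply, eta_apply] at h1
    simpa using h1
  · intro h
    funext z
    ext v
    rw [pullback_eta_apply, eta_apply, h, map_one, one_mul]

/-- The derivation kills `φ₀` and sends `φ₁` to the Jacobian `1`. The coordinates are polynomials in
`φ₀, φ₁` through the inverse of `φ`, and the nilpotent elements form a subalgebra. -/
theorem isLocallyNilpotent_of_mem_autEta {φ : polyAut 2} (hφ : φ ∈ AutEta) :
    IsLocallyNilpotent (jac (coordPoly φ 0)) := by
  have hP (i : Fin 2) : coordPoly φ i ∈ nilpotentElements (jac (coordPoly φ 0)) := by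
    fin_cases i
    · exact ⟨1, jac_self _⟩
    · refine mem_nilpotentElements_of_map_mem _ ?_
      simp only [Fin.mk_one]
      rw [mem_autEta_iff.1 hφ]
      exact one_mem _
  refine jac_isLocallyNilpotent fun i => ?_
  have h : X i = aeval (coordPoly φ) (coordPoly φ⁻¹ i) := by
    rw [← coordPoly_mul, inv_mul_cancel, coordPoly_one]
  rw [← mem_nilpotentElements, h, aeval_def, eval₂_eq]
  exact sum_mem fun d _ => mul_mem (Subalgebra.algebraMap_mem _ _)
    (prod_mem fun i _ => pow_mem (hP i) _)

theorem eval_aeval_X {n : ℕ} (p : Polynomial ℂ) (i : Fin n) (z : Aff n) :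
    eval z (Polynomial.aeval (X i : MvPolynomial (Fin n) ℂ) p) = p.eval (z i) := by
  rw [← Polynomial.coe_aeval_eq_eval, ← MvPolynomial.coe_aeval_eq_eval, RingHom.coe_coe,
    ← Polynomial.aeval_algHom_apply, aeval_X]

theorem pderiv_aeval_X {n : ℕ} (p : Polynomial ℂ) (i j : Fin n) :
    pderiv j (Polynomial.aeval (X i : MvPolynomial (Fin n) ℂ) p) =
      Polynomial.aeval (X i) p.derivative * pderiv j (X i) := by
  rw [Derivation.map_aeval, smul_eq_mul]

/-- The elementary automorphism `(z₀ + p(z₁), z₁)`. -/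
def elementary (p : Polynomial ℂ) : polyAut 2 :=
  mkPolyAut (fun z => ![z 0 + p.eval (z 1), z 1]) (fun z => ![z 0 - p.eval (z 1), z 1])
    ⟨![X 0 + Polynomial.aeval (X 1) p, X 1], fun z i => by
      fin_cases i <;> simp [eval_aeval_X]⟩
    ⟨![X 0 - Polynomial.aeval (X 1) p, X 1], fun z i => by
      fin_cases i <;> simp [eval_aeval_X]⟩
    (fun z => by ext i; fin_cases i <;> simp)
    (fun z => by ext i; fin_cases i <;> simp)

/-- The elementary automorphism `(z₀, z₁ + p(z₀))`. -/
def elementary' (p : Polynomial ℂ) : polyAut 2 :=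
  mkPolyAut (fun z => ![z 0, z 1 + p.eval (z 0)]) (fun z => ![z 0, z 1 - p.eval (z 0)])
    ⟨![X 0, X 1 + Polynomial.aeval (X 0) p], fun z i => by
      fin_cases i <;> simp [eval_aeval_X]⟩
    ⟨![X 0, X 1 - Polynomial.aeval (X 0) p], fun z i => by
      fin_cases i <;> simp [eval_aeval_X]⟩
    (fun z => by ext i; fin_cases i <;> simp)
    (fun z => by ext i; fin_cases i <;> simp)

/-- The rotation `(-z₁, z₀)`. -/
def rotation : polyAut 2 :=
  mkPolyAut (fun z => ![-z 1, z 0]) (fun z => ![z 1, -z 0])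
    ⟨![-X 1, X 0], fun z i => by fin_cases i <;> simp⟩
    ⟨![X 1, -X 0], fun z i => by fin_cases i <;> simp⟩
    (fun z => by ext i; fin_cases i <;> simp)
    (fun z => by ext i; fin_cases i <;> simp)

/-- The diagonal automorphism `(t z₀, t⁻¹ z₁)`. -/
def diagonal (t : ℂ) (ht : t ≠ 0) : polyAut 2 :=
  mkPolyAut (fun z => ![t * z 0, t⁻¹ * z 1]) (fun z => ![t⁻¹ * z 0, t * z 1])
    ⟨![C t * X 0, C t⁻¹ * X 1], fun z i => by fin_cases i <;> simp⟩
    ⟨![C t⁻¹ * X 0, C t * X 1], fun z i => by fin_cases i <;> simp⟩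
    (fun z => by ext i; fin_cases i <;> simp [ht])
    (fun z => by ext i; fin_cases i <;> simp [ht])

theorem toMap_elementary (p : Polynomial ℂ) (z : Aff 2) :
    toMap (elementary p) z = ![z 0 + p.eval (z 1), z 1] := rfl

theorem toMap_elementary_inv (p : Polynomial ℂ) (z : Aff 2) :
    toMap (elementary p)⁻¹ z = ![z 0 - p.eval (z 1), z 1] := rfl

theorem toMap_elementary' (p : Polynomial ℂ) (z : Aff 2) :
    toMap (elementary' p) z = ![z 0, z 1 + p.eval (z 0)] := rfl

theorem toMap_rotation (z : Aff 2) : toMap rotation z = ![-z 1, z 0] := rfl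

theorem toMap_rotation_inv (z : Aff 2) : toMap rotation⁻¹ z = ![z 1, -z 0] := rfl

theorem toMap_diagonal (t : ℂ) (ht : t ≠ 0) (z : Aff 2) :
    toMap (diagonal t ht) z = ![t * z 0, t⁻¹ * z 1] := rfl

theorem toMap_diagonal_inv (t : ℂ) (ht : t ≠ 0) (z : Aff 2) :
    toMap (diagonal t ht)⁻¹ z = ![t⁻¹ * z 0, t * z 1] := rfl

theorem elementary'_eq (p : Polynomial ℂ) :
    elementary' p = rotation * elementary (p.comp (-Polynomial.X)) * rotation⁻¹ := by
  refine polyAut_ext fun z => ?_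
  simp only [toMap_mul, Function.comp_apply, toMap_elementary, toMap_elementary', toMap_rotation,
    toMap_rotation_inv]
  ext i
  fin_cases i <;> simp

/-- The identity `diag(t, t⁻¹) = w(t) w(1)⁻¹` in `SL₂`, where `w(t)` is the product of the first
three factors and the rotation is `w(-1) = w(1)⁻¹`. -/
theorem diagonal_eq (t : ℂ) (ht : t ≠ 0) :
    diagonal t ht = elementary (Polynomial.C t * Polynomial.X) *
      elementary' (Polynomial.C (-t⁻¹) * Polynomial.X) *
      elementary (Polynomial.C t * Polynomial.X) * rotation := by
  refine polyAut_ext fun z => ?_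
  simp only [toMap_mul, Function.comp_apply, toMap_elementary, toMap_elementary', toMap_rotation,
    toMap_diagonal]
  ext i
  fin_cases i
  · simp; field_simp; ring
  · simp; field_simp; ring

theorem rotation_eq :
    rotation = elementary (-Polynomial.X) * elementary' Polynomial.X *
      elementary (-Polynomial.X) := by
  refine polyAut_ext fun z => ?_
  simp only [toMap_mul, Function.comp_apply, toMap_elementary, toMap_elementary', toMap_rotation]
  ext i
  fin_cases i <;> simp

theorem elementary_mem_autEta (p : Polynomial ℂ) : elementary p ∈ AutEta := by
  have h0 : coordPoly (elementary p) 0 = X 0 + Polynomial.aeval (X 1) p :=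
    coordPoly_eq_iff.2 fun z => by simp [toMap_elementary, eval_aeval_X]
  have h1 : coordPoly (elementary p) 1 = X 1 := coordPoly_eq_iff.2 fun z => by
    simp [toMap_elementary]
  rw [mem_autEta_iff, h0, h1, jac_apply]
  simp [pderiv_X]

theorem rotation_mem_autEta : rotation ∈ AutEta := by
  have h0 : coordPoly rotation 0 = -X 1 := coordPoly_eq_iff.2 fun z => by simp [toMap_rotation]
  have h1 : coordPoly rotation 1 = X 0 := coordPoly_eq_iff.2 fun z => by simp [toMap_rotation]
  rw [mem_autEta_iff, h0, h1, jac_apply]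
  simp [pderiv_X]

theorem elementary'_mem {S : Subgroup (polyAut 2)} (he : ∀ p, elementary p ∈ S)
    (hr : rotation ∈ S) (p : Polynomial ℂ) : elementary' p ∈ S := by
  rw [elementary'_eq]
  exact mul_mem (mul_mem hr (he _)) (inv_mem hr)

theorem diagonal_mem {S : Subgroup (polyAut 2)} (he : ∀ p, elementary p ∈ S)
    (hr : rotation ∈ S) (t : ℂ) (ht : t ≠ 0) : diagonal t ht ∈ S := by
  rw [diagonal_eq]
  exact mul_mem (mul_mem (mul_mem (he _) (elementary'_mem he hr _)) (he _)) hr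

theorem exists_eq_aeval_X {i j : Fin 2} (hij : i ≠ j) {f : MvPolynomial (Fin 2) ℂ}
    (h : ∀ d, coeff d f ≠ 0 → d i = 0) : ∃ p : Polynomial ℂ, f = Polynomial.aeval (X j) p := by
  refine ⟨∑ d ∈ f.support, Polynomial.monomial (d j) (coeff d f), ?_⟩
  conv_lhs => rw [f.as_sum]
  rw [map_sum]
  refine Finset.sum_congr rfl fun d hd => ?_
  have h0 := h d (mem_support_iff.1 hd)
  rw [Polynomial.aeval_monomial, monomial_fin_two, algebraMap_eq]
  fin_cases i <;> fin_cases j <;> simp_all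

theorem exists_eq_aeval_X_of_pderiv {i j : Fin 2} (hij : i ≠ j) {f : MvPolynomial (Fin 2) ℂ}
    (h : pderiv i f = 0) : ∃ p : Polynomial ℂ, f = Polynomial.aeval (X j) p :=
  exists_eq_aeval_X hij fun _ hd => by
    by_contra h0
    exact hd (coeff_eq_zero_of_pderiv_eq_zero h h0)

theorem eq_C_of_pderiv_eq_zero {n : ℕ} {f : MvPolynomial (Fin n) ℂ} (h : ∀ i, pderiv i f = 0) :
    f = C (coeff 0 f) := by
  ext d
  rw [coeff_C]
  split_ifs with hd
  · rw [hd]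
  · obtain ⟨i, hi⟩ := Finsupp.ne_iff.1 (Ne.symm hd)
    exact coeff_eq_zero_of_pderiv_eq_zero (h i) hi

/-- Base case of Jung's theorem: the Jacobian condition becomes `∂₀φ₀ ∂₁φ₁ = 1`, so both factors are
constants and `φ = (α z₀ + β, α⁻¹ z₁ + τ(z₀))`. -/
theorem mem_of_pderiv_eq_zero {S : Subgroup (polyAut 2)} (he : ∀ p, elementary p ∈ S)
    (hr : rotation ∈ S) {φ : polyAut 2} (hφ : φ ∈ AutEta)
    (h : pderiv 1 (coordPoly φ 0) = 0) : φ ∈ S := by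
  have hJ := mem_autEta_iff.1 hφ
  rw [jac_apply, h, zero_mul, sub_zero] at hJ
  obtain ⟨α, hα, hα'⟩ := isUnit_iff_eq_C_of_isReduced.1 (IsUnit.of_mul_eq_one _ hJ)
  have hα0 : α ≠ 0 := hα.ne_zero
  have h1 : pderiv 1 (coordPoly φ 1) = C α⁻¹ := by
    have h2 : (C α⁻¹ * C α : MvPolynomial (Fin 2) ℂ) = 1 := by
      rw [← map_mul, inv_mul_cancel₀ hα0, map_one]
    rw [hα'] at hJ
    linear_combination C α⁻¹ * hJ - pderiv 1 (coordPoly φ 1) * h2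
  obtain ⟨β, hβ⟩ : ∃ β, coordPoly φ 0 - C α * X 0 = C β := by
    refine ⟨_, eq_C_of_pderiv_eq_zero fun i => ?_⟩
    fin_cases i
    · simp [hα', pderiv_X]
    · simp [h, pderiv_X]
  obtain ⟨τ, hτ⟩ : ∃ τ : Polynomial ℂ,
      coordPoly φ 1 - C α⁻¹ * X 1 = Polynomial.aeval (X 0) τ := by
    refine exists_eq_aeval_X_of_pderiv (i := 1) (by decide) ?_
    simp [h1]
  have h2 : φ = elementary (Polynomial.C β) * diagonal α hα0 *
      elementary' (Polynomial.C α * τ) := by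
    refine polyAut_ext fun z => ?_
    simp only [toMap_mul, Function.comp_apply, toMap_elementary, toMap_elementary',
      toMap_diagonal]
    ext i
    rw [toMap_apply_eq_eval]
    fin_cases i
    · have := congrArg (eval z) hβ
      simp only [map_sub, map_mul, eval_C, eval_X, sub_eq_iff_eq_add] at this
      simp [this, add_comm]
    · have := congrArg (eval z) hτ
      simp only [map_sub, map_mul, eval_C, eval_X, sub_eq_iff_eq_add, eval_aeval_X] at this
      simp [this, mul_add, hα0, add_comm]
  rw [h2]
  exact mul_mem (mul_mem (he _) (diagonal_mem he hr _ _)) (elementary'_mem he hr _)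

theorem exists_coordPoly_eq_shear {S : Subgroup (polyAut 2)} (he : ∀ p, elementary p ∈ S)
    (hr : rotation ∈ S) {i j : Fin 2} (hij : i ≠ j) (c : ℂ) (p : ℕ) :
    ∃ s ∈ S, ∀ k, coordPoly s k = Function.update X j (X j + C c * X i ^ p) k := by
  have h : (i = 0 ∧ j = 1) ∨ (i = 1 ∧ j = 0) := by fin_cases i <;> fin_cases j <;> simp_all
  rcases h with ⟨rfl, rfl⟩ | ⟨rfl, rfl⟩
  · refine ⟨elementary' (Polynomial.C c * Polynomial.X ^ p), elementary'_mem he hr _, fun k => ?_⟩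
    rw [coordPoly_eq_iff]
    intro z
    rw [toMap_elementary']
    fin_cases k <;> simp
  · refine ⟨elementary (Polynomial.C c * Polynomial.X ^ p), he _, fun k => ?_⟩
    rw [coordPoly_eq_iff]
    intro z
    rw [toMap_elementary]
    fin_cases k <;> simp

/-- Jung's theorem: the elementary automorphisms and the rotation generate `Aut(ℂ²)_η`. -/
theorem autEta_le {S : Subgroup (polyAut 2)} (he : ∀ p, elementary p ∈ S) (hr : rotation ∈ S) :
    AutEta ≤ S := by
  -- Induction on the sum of the two partial degrees of `φ₀`; the component `φ₁` plays no role in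
  -- the descent.
  suffices H : ∀ N, ∀ φ ∈ AutEta,
      degreeOf 0 (coordPoly φ 0) + degreeOf 1 (coordPoly φ 0) = N → φ ∈ S from
    fun φ hφ => H _ φ hφ rfl
  intro N
  induction N using Nat.strong_induction_on with
  | _ N ih =>
  intro φ hφ hN
  have hdeg (i : Fin 2) (h : degreeOf i (coordPoly φ 0) = 0) (d) (hd : coeff d (coordPoly φ 0) ≠ 0) :
      d i = 0 := Nat.le_zero.1 (h ▸ le_degreeOf hd i)
  by_cases h1 : degreeOf 1 (coordPoly φ 0) = 0
  · obtain ⟨p, hp⟩ := exists_eq_aeval_X (j := 0) (by decide) (hdeg 1 h1)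
    refine mem_of_pderiv_eq_zero he hr hφ ?_
    rw [hp, pderiv_aeval_X, pderiv_X_of_ne (by decide), mul_zero]
  by_cases h0 : degreeOf 0 (coordPoly φ 0) = 0
  · obtain ⟨p, hp⟩ := exists_eq_aeval_X (j := 1) (by decide) (hdeg 0 h0)
    -- Precomposing with the rotation turns a first component in `z₁` alone into one in `z₀` alone.
    refine (mul_mem_cancel_right hr).1
      (mem_of_pderiv_eq_zero he hr (mul_mem hφ rotation_mem_autEta) ?_)
    have : coordPoly (φ * rotation) 0 = Polynomial.aeval (X 0) p := by
      rw [coordPoly_eq_iff]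
      intro z
      rw [toMap_mul, Function.comp_apply, toMap_apply_eq_eval, hp, eval_aeval_X, eval_aeval_X]
      rfl
    rw [this, pderiv_aeval_X, pderiv_X_of_ne (by decide), mul_zero]
  obtain ⟨i, j, hij, c, p, hi, hj⟩ := (isLocallyNilpotent_of_mem_autEta hφ).exists_shear h0 h1
  -- Using `S ⊓ AutEta` keeps `φ * s` in `AutEta`, as the induction hypothesis requires.
  obtain ⟨s, hs', hs⟩ := exists_coordPoly_eq_shear (S := S ⊓ AutEta)
    (fun p => ⟨he p, elementary_mem_autEta p⟩) ⟨hr, rotation_mem_autEta⟩ hij c p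
  obtain ⟨hsS, hsE⟩ := Subgroup.mem_inf.1 hs'
  refine (mul_mem_cancel_right hsS).1 (ih _ ?_ _ (mul_mem hφ hsE) rfl)
  rw [coordPoly_mul, funext hs, ← hN]
  change degreeOf 0 (shear i j c p _) + degreeOf 1 (shear i j c p _) < _
  have h : (i = 0 ∧ j = 1) ∨ (i = 1 ∧ j = 0) := by fin_cases i <;> fin_cases j <;> simp_all
  rcases h with ⟨rfl, rfl⟩ | ⟨rfl, rfl⟩ <;> omega

/-- The commutator of `diag(2, 1/2)` with `(z₀ + q(z₁), z₁)` adds `2 q(2 z₁) - q(z₁)` to `z₀`. This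
operator on polynomials is onto, since `x^n` is an eigenvector of eigenvalue `2^(n+1) - 1 ≠ 0`. -/
theorem exists_two_mul_eval_sub (p : Polynomial ℂ) :
    ∃ q : Polynomial ℂ, ∀ x, 2 * q.eval (2 * x) - q.eval x = p.eval x := by
  induction p using Polynomial.induction_on' with
  | add p₁ p₂ h₁ h₂ =>
    obtain ⟨q₁, hq₁⟩ := h₁
    obtain ⟨q₂, hq₂⟩ := h₂
    refine ⟨q₁ + q₂, fun x => ?_⟩
    rw [Polynomial.eval_add, Polynomial.eval_add, Polynomial.eval_add, ← hq₁, ← hq₂]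
    ring
  | monomial n a =>
    have h : (2 : ℂ) ^ (n + 1) - 1 ≠ 0 := by
      rw [sub_ne_zero]
      exact_mod_cast (Nat.one_lt_two_pow (Nat.succ_ne_zero n)).ne'
    refine ⟨Polynomial.monomial n (a / (2 ^ (n + 1) - 1)), fun x => ?_⟩
    simp only [Polynomial.eval_monomial]
    field_simp
    ring

theorem commutator_autEta : ⁅AutEta, AutEta⁆ = AutEta := by
  have he (p : Polynomial ℂ) : elementary p ∈ ⁅AutEta, AutEta⁆ := by
    obtain ⟨q, hq⟩ := exists_two_mul_eval_sub p
    have h : elementary p = ⁅diagonal 2 two_ne_zero, elementary q⁆ := by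
      refine polyAut_ext fun z => ?_
      simp only [commutatorElement_def, toMap_mul, Function.comp_apply, toMap_elementary,
        toMap_elementary_inv, toMap_diagonal, toMap_diagonal_inv]
      ext i
      fin_cases i
      · simp [← hq]; ring
      · simp
    rw [h]
    exact Subgroup.commutator_mem_commutator
      (diagonal_mem elementary_mem_autEta rotation_mem_autEta _ _) (elementary_mem_autEta q)
  have hle : ⁅AutEta, AutEta⁆ ≤ AutEta := by
    rw [Subgroup.commutator_le]
    intro a ha b hb
    rw [commutatorElement_def]
    exact mul_mem (mul_mem (mul_mem ha hb) (inv_mem ha)) (inv_mem hb)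
  refine le_antisymm hle (autEta_le he ?_)
  have he' : elementary' Polynomial.X ∈ ⁅AutEta, AutEta⁆ := by
    rw [elementary'_eq]
    -- The conjugate `r e r⁻¹` equals `⁅r, e⁆ * e`, and `e` is already known to be in the derived
    -- group.
    have h := Subgroup.commutator_mem_commutator rotation_mem_autEta
      (elementary_mem_autEta (Polynomial.X.comp (-Polynomial.X)))
    have h2 := mul_mem h (he (Polynomial.X.comp (-Polynomial.X)))
    rwa [commutatorElement_def, inv_mul_cancel_right] at h2
  rw [rotation_eq]
  exact mul_mem (mul_mem (he _) he') (he _)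

/-! ### Contact automorphisms of `ℂ³` -/

theorem pderiv_comm {σ : Type*} (i j : σ) (f : MvPolynomial σ ℂ) :
    pderiv i (pderiv j f) = pderiv j (pderiv i f) := by
  classical
  have h : ⁅pderiv (R := ℂ) i, pderiv (R := ℂ) j⁆ = 0 := by
    refine derivation_ext fun k => ?_
    simp only [Derivation.commutator_apply, pderiv_X, Pi.single_apply, apply_ite,
      map_zero, Derivation.map_one_eq_zero, ite_self, sub_self, Derivation.coe_zero,
      Pi.zero_apply]
  have h2 := DFunLike.congr_fun h f
  rwa [Derivation.commutator_apply, Derivation.zero_apply, sub_eq_zero] at h2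

/-- The coefficients of the `1`-form `φ^*ω`. -/
def contactCoeff (φ : polyAut 3) (i : Fin 3) : MvPolynomial (Fin 3) ℂ :=
  coordPoly φ 0 * pderiv i (coordPoly φ 1) + pderiv i (coordPoly φ 2)

theorem omega_apply (z v : Aff 3) : omega z v = z 0 * v 1 + v 2 := by
  simp [omega, dz]

theorem pullback_omega_apply (φ : polyAut 3) (z v : Aff 3) :
    pullback₁ (toMap φ) omega z v = ∑ i, eval z (contactCoeff φ i) * v i := by
  have h : pullback₁ (toMap φ) omega z v = omega (toMap φ z) (fderiv ℂ (toMap φ) z v) := rfl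
  rw [h, omega_apply, fderiv_toMap, fderiv_toMap, Finset.mul_sum, ← Finset.sum_add_distrib]
  refine Finset.sum_congr rfl fun i _ => ?_
  rw [contactCoeff, map_add, map_mul, toMap_apply_eq_eval]
  ring

theorem pullback_omega_eq_smul_iff {φ : polyAut 3} {γ : ℂ} :
    pullback₁ (toMap φ) omega = γ • omega ↔
      ∀ i, contactCoeff φ i = ![0, C γ * X 0, C γ] i := by
  constructor
  · intro h i
    refine MvPolynomial.funext fun z => ?_
    have h1 := DFunLike.congr_fun (congrFun h z) (Pi.single i 1)
    rw [pullback_omega_apply, Pi.smul_apply, smul_apply, omega_apply] at h1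
    simp only [Pi.single_apply, mul_ite, mul_one, mul_zero, Finset.sum_ite_eq',
      Finset.mem_univ, if_true] at h1
    rw [h1]
    fin_cases i <;> simp
  · intro h
    funext z
    refine ContinuousLinearMap.ext fun v => ?_
    rw [pullback_omega_apply, Pi.smul_apply, smul_apply, omega_apply]
    simp only [h, Fin.sum_univ_three]
    simp
    ring

theorem mem_autOmega_iff {φ : polyAut 3} :
    φ ∈ AutOmega ↔ ∀ i, contactCoeff φ i = ![0, X 0, 1] i := by
  have h := pullback_omega_eq_smul_iff (φ := φ) (γ := 1)
  rw [one_smul, map_one, one_mul] at h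
  exact h

theorem autOmega_le_autContactOmega : AutOmega ≤ AutContactOmega := by
  intro φ hφ
  have h : pullback₁ (toMap φ) omega = omega := hφ
  change wedge (pullback₁ (toMap φ) omega) omega = 0
  rw [wedge_eq_zero_iff omega_ne_zero, h]
  exact fun z => ⟨1, (one_smul _ _).symm⟩

theorem pullback_omega_eq_eval_smul {φ : polyAut 3} (hφ : φ ∈ AutContactOmega) (z : Aff 3) :
    pullback₁ (toMap φ) omega z = eval z (contactCoeff φ 2) • omega z := by
  obtain ⟨c, hc⟩ := (wedge_eq_zero_iff omega_ne_zero).1 hφ z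
  have h := DFunLike.congr_fun hc (Pi.single 2 1)
  rw [pullback_omega_apply, smul_apply, omega_apply] at h
  simp [Pi.single_apply] at h
  rw [hc, h]

/-- The conformal factor is the polynomial `contactCoeff φ 2`. Its product with the pulled back
factor of `φ⁻¹` is `1`, and units among polynomials are constants. -/
theorem exists_pullback_omega_eq_smul {φ : polyAut 3} (hφ : φ ∈ AutContactOmega) :
    ∃ γ : ℂ, pullback₁ (toMap φ) omega = γ • omega := by
  have h : aeval (coordPoly φ) (contactCoeff φ⁻¹ 2) * contactCoeff φ 2 = 1 := by
    refine MvPolynomial.funext fun z => ?_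
    have h1 := congrFun (pullback₁_mul φ⁻¹ φ omega) z
    rw [inv_mul_cancel, toMap_one, pullback₁_id] at h1
    change omega z = (pullback₁ (toMap φ⁻¹) omega (toMap φ z)).comp (fderiv ℂ (toMap φ) z) at h1
    rw [pullback_omega_eq_eval_smul (inv_mem hφ), ContinuousLinearMap.smul_comp] at h1
    change omega z = _ • pullback₁ (toMap φ) omega z at h1
    rw [pullback_omega_eq_eval_smul hφ, smul_smul] at h1
    have h2 := DFunLike.congr_fun h1 (Pi.single 2 1)
    rw [smul_apply, omega_apply] at h2
    simp at h2
    rw [map_mul, eval_aeval_eq, map_one, h2]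
    congr 3
    funext i
    rw [toMap_apply_eq_eval]
  obtain ⟨γ, -, hγ⟩ := isUnit_iff_eq_C_of_isReduced.1 (IsUnit.of_mul_eq_one_right _ h)
  refine ⟨γ, funext fun z => ?_⟩
  rw [pullback_omega_eq_eval_smul hφ, hγ, eval_C]
  rfl

theorem pullback₁_smul {n : ℕ} (f : Aff n → Aff n) (c : ℂ) (β : OneForm n) :
    pullback₁ f (c • β) = c • pullback₁ f β := by
  funext z
  exact ContinuousLinearMap.smul_comp _ _ _

/-- The constant factors commute, so `φ * ψ` and `ψ * φ` pull `ω` back to the same form. -/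
theorem commutatorElement_mem_autOmega {φ ψ : polyAut 3} (hφ : φ ∈ AutContactOmega)
    (hψ : ψ ∈ AutContactOmega) : ⁅φ, ψ⁆ ∈ AutOmega := by
  obtain ⟨a, ha⟩ := exists_pullback_omega_eq_smul hφ
  obtain ⟨b, hb⟩ := exists_pullback_omega_eq_smul hψ
  have h : pullback₁ (toMap (φ * ψ)) omega = pullback₁ (toMap (ψ * φ)) omega := by
    rw [pullback₁_mul, pullback₁_mul, ha, hb, pullback₁_smul, pullback₁_smul, ha, hb,
      smul_comm]
  change pullback₁ (toMap ⁅φ, ψ⁆) omega = omega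
  rw [show ⁅φ, ψ⁆ = φ * ψ * (ψ * φ)⁻¹ by rw [commutatorElement_def]; group, pullback₁_mul, h,
    ← pullback₁_mul, mul_inv_cancel, toMap_one, pullback₁_id]

/-- The identity `d(φ^*ω) = dφ₀ ∧ dφ₁` in coefficients. -/
theorem pderiv_contactCoeff_sub (φ : polyAut 3) (i j : Fin 3) :
    pderiv i (contactCoeff φ j) - pderiv j (contactCoeff φ i) =
      pderiv i (coordPoly φ 0) * pderiv j (coordPoly φ 1) -
        pderiv j (coordPoly φ 0) * pderiv i (coordPoly φ 1) := by
  simp only [contactCoeff, map_add, Derivation.leibniz, smul_eq_mul]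
  rw [pderiv_comm i j (coordPoly φ 1), pderiv_comm i j (coordPoly φ 2)]
  ring

theorem minor_eq_of_pullback {φ : polyAut 3} {γ : ℂ}
    (h : pullback₁ (toMap φ) omega = γ • omega) :
    pderiv 0 (coordPoly φ 0) * pderiv 1 (coordPoly φ 1) -
        pderiv 1 (coordPoly φ 0) * pderiv 0 (coordPoly φ 1) = C γ := by
  rw [← pderiv_contactCoeff_sub, pullback_omega_eq_smul_iff.1 h, pullback_omega_eq_smul_iff.1 h]
  simp

theorem scalar_ne_zero {φ : polyAut 3} {γ : ℂ} (h : pullback₁ (toMap φ) omega = γ • omega) :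
    γ ≠ 0 := by
  rintro rfl
  have h1 := pullback₁_mul φ φ⁻¹ omega
  rw [mul_inv_cancel, toMap_one, pullback₁_id, h, pullback₁_smul] at h1
  exact omega_ne_zero 0 ((congrFun h1 0).trans (zero_smul ℂ (pullback₁ (toMap φ⁻¹) omega 0)))

/-- As `d(φ^*ω) = γ dz₀ ∧ dz₁`, the vector `∂₂(φ₀, φ₁)` has zero determinant with `∂₀(φ₀, φ₁)` and
`∂₁(φ₀, φ₁)`, whose own determinant is `γ ≠ 0`. -/
theorem pderiv_two_coordPoly_eq_zero {φ : polyAut 3} (hφ : φ ∈ AutContactOmega) :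
    pderiv 2 (coordPoly φ 0) = 0 ∧ pderiv 2 (coordPoly φ 1) = 0 := by
  obtain ⟨γ, h⟩ := exists_pullback_omega_eq_smul hφ
  have hγ : (C γ : MvPolynomial (Fin 3) ℂ) ≠ 0 := by simpa using scalar_ne_zero h
  have h01 := minor_eq_of_pullback h
  have h02 := pderiv_contactCoeff_sub φ 0 2
  have h12 := pderiv_contactCoeff_sub φ 1 2
  rw [pullback_omega_eq_smul_iff.1 h, pullback_omega_eq_smul_iff.1 h] at h02 h12
  simp [pderiv_X] at h02 h12
  constructor
  · refine (mul_eq_zero.1 ?_).resolve_left hγ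
    rw [← h01]
    linear_combination pderiv 0 (coordPoly φ 0) * h12 - pderiv 1 (coordPoly φ 0) * h02
  · refine (mul_eq_zero.1 ?_).resolve_left hγ
    rw [← h01]
    linear_combination pderiv 0 (coordPoly φ 1) * h12 - pderiv 1 (coordPoly φ 1) * h02

theorem eval_eq_of_pderiv_eq_zero {n : ℕ} {i : Fin n} {f : MvPolynomial (Fin n) ℂ}
    (h : pderiv i f = 0) {z z' : Aff n} (hz : ∀ j ≠ i, z j = z' j) : eval z f = eval z' f := by
  rw [eval_eq', eval_eq']
  refine Finset.sum_congr rfl fun d hd => congrArg _ (Finset.prod_congr rfl fun j _ => ?_)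
  rcases eq_or_ne j i with rfl | hj
  · have hdj : d j = 0 := by
      by_contra h0
      exact mem_support_iff.1 hd (coeff_eq_zero_of_pderiv_eq_zero h h0)
    rw [hdj, pow_zero, pow_zero]
  · rw [hz j hj]

theorem proj01_toMap_eq {φ : polyAut 3} (hφ : φ ∈ AutContactOmega) {z z' : Aff 3}
    (h : proj01 z = proj01 z') : proj01 (toMap φ z) = proj01 (toMap φ z') := by
  have hz : ∀ j ≠ (2 : Fin 3), z j = z' j := by
    intro j hj
    fin_cases j
    · exact congrFun h 0
    · exact congrFun h 1
    · exact absurd rfl hj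
  obtain ⟨h0, h1⟩ := pderiv_two_coordPoly_eq_zero hφ
  simp only [proj01, toMap_apply_eq_eval]
  rw [eval_eq_of_pderiv_eq_zero h0 hz, eval_eq_of_pderiv_eq_zero h1 hz]

/-- The plane `z₂ = 0` in `ℂ³`. -/
def plane (z : Aff 2) : Aff 3 := ![z 0, z 1, 0]

theorem proj01_plane (z : Aff 2) : proj01 (plane z) = z := by
  ext i
  fin_cases i <;> rfl

theorem isPolyMap_proj01 : IsPolyMap proj01 :=
  ⟨![X 0, X 1], fun z i => by fin_cases i <;> simp [proj01]⟩

theorem isPolyMap_plane : IsPolyMap plane :=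
  ⟨![X 0, X 1, 0], fun z i => by fin_cases i <;> simp [plane]⟩

/-- The homomorphism `φ ↦ (φ₀, φ₁)`. -/
def projHom : AutContactOmega →* polyAut 2 where
  toFun φ := mkPolyAut (fun z => proj01 (toMap (φ : polyAut 3) (plane z)))
    (fun z => proj01 (toMap (φ : polyAut 3)⁻¹ (plane z)))
    (isPolyMap_proj01.comp ((φ : polyAut 3).2.1.comp isPolyMap_plane))
    (isPolyMap_proj01.comp ((φ : polyAut 3)⁻¹.2.1.comp isPolyMap_plane))
    (fun z => by
      rw [proj01_toMap_eq (inv_mem φ.2) (proj01_plane _), toMap_inv_apply, proj01_plane])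
    (fun z => by
      rw [proj01_toMap_eq φ.2 (proj01_plane _), toMap_apply_inv, proj01_plane])
  map_one' := polyAut_ext fun z => proj01_plane z
  map_mul' φ ψ := polyAut_ext fun z =>
    proj01_toMap_eq φ.2 (proj01_plane (proj01 (toMap (ψ : polyAut 3) (plane z)))).symm

theorem toMap_projHom (φ : AutContactOmega) (z : Aff 2) :
    toMap (projHom φ) z = proj01 (toMap (φ : polyAut 3) (plane z)) := rfl

theorem isProjection_projHom (φ : AutContactOmega) : IsProjection φ (projHom φ) := fun z => by
  rw [toMap_projHom]
  exact proj01_toMap_eq φ.2 (proj01_plane _)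

theorem projHom_eq_iff {φ : AutContactOmega} {ψ : polyAut 2} :
    projHom φ = ψ ↔ IsProjection φ ψ := by
  refine ⟨fun h => h ▸ isProjection_projHom φ, fun h => polyAut_ext fun z => ?_⟩
  rw [toMap_projHom, ← h, proj01_plane]

theorem coordPoly_castSucc (φ : AutContactOmega) (k : Fin 2) :
    coordPoly (φ : polyAut 3) k.castSucc = rename Fin.castSucc (coordPoly (projHom φ) k) := by
  rw [coordPoly_eq_iff]
  intro z
  have h1 := congrFun (isProjection_projHom φ z) k
  have h2 : z ∘ Fin.castSucc = proj01 z := by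
    funext i
    fin_cases i <;> rfl
  rw [eval_rename, h2, ← toMap_apply_eq_eval, h1]
  fin_cases k <;> rfl

theorem jac_projHom (φ : AutContactOmega) {γ : ℂ}
    (h : pullback₁ (toMap (φ : polyAut 3)) omega = γ • omega) :
    jac (coordPoly (projHom φ) 0) (coordPoly (projHom φ) 1) = C γ := by
  have h0 : coordPoly (φ : polyAut 3) 0 = _ := coordPoly_castSucc φ 0
  have h1 : coordPoly (φ : polyAut 3) 1 = _ := coordPoly_castSucc φ 1
  have e (i : Fin 2) (p : MvPolynomial (Fin 2) ℂ) : pderiv i.castSucc (rename Fin.castSucc p) =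
      rename Fin.castSucc (pderiv i p) := pderiv_rename (Fin.castSucc_injective 2) i p
  have e0 : ∀ p : MvPolynomial (Fin 2) ℂ, pderiv (0 : Fin 3) (rename Fin.castSucc p) = _ := e 0
  have e1 : ∀ p : MvPolynomial (Fin 2) ℂ, pderiv (1 : Fin 3) (rename Fin.castSucc p) = _ := e 1
  have h2 := minor_eq_of_pullback h
  rw [h0, h1, e0, e0, e1, e1] at h2
  refine rename_injective _ (Fin.castSucc_injective 2) ?_
  rw [jac_apply, map_sub, map_mul, map_mul, h2, rename_C]

/-- Both sides say `γ = 1`, because the conformal factor of `φ` is the Jacobian of its projection.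
-/
theorem projHom_mem_autEta_iff (φ : AutContactOmega) :
    projHom φ ∈ AutEta ↔ (φ : polyAut 3) ∈ AutOmega := by
  obtain ⟨γ, h⟩ := exists_pullback_omega_eq_smul φ.2
  rw [mem_autEta_iff, jac_projHom φ h]
  change _ ↔ pullback₁ _ omega = omega
  constructor
  · intro h1
    obtain rfl : γ = 1 := C_injective _ _ (by rw [h1, map_one])
    rw [h, one_smul]
  · intro h1
    have h2 := DFunLike.congr_fun (congrFun (h.symm.trans h1) 0) (Pi.single 2 1)
    rw [Pi.smul_apply, smul_apply, omega_apply] at h2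
    simp at h2
    rw [h2, map_one]

/-- The identity is in `AutEta`, so `φ` preserves `ω`; with `φ₀ = z₀` and `φ₁ = z₁` this leaves
`d(φ₂ - z₂) = 0`. -/
theorem projHom_eq_one_iff (φ : AutContactOmega) :
    projHom φ = 1 ↔ IsVerticalTranslation φ := by
  rw [projHom_eq_iff]
  constructor
  · intro h
    have hproj (z : Aff 3) : proj01 (toMap (φ : polyAut 3) z) = proj01 z := (h z).symm
    have h0 : coordPoly (φ : polyAut 3) 0 = X 0 := coordPoly_eq_iff.2 fun z => by
      rw [eval_X]; exact congrFun (hproj z) 0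
    have h1 : coordPoly (φ : polyAut 3) 1 = X 1 := coordPoly_eq_iff.2 fun z => by
      rw [eval_X]; exact congrFun (hproj z) 1
    have hω : (φ : polyAut 3) ∈ AutOmega := by
      rw [← projHom_mem_autEta_iff, projHom_eq_iff.2 h]
      exact one_mem _
    rw [mem_autOmega_iff] at hω
    have h2 : coordPoly (φ : polyAut 3) 2 - X 2 =
        C (coeff 0 (coordPoly (φ : polyAut 3) 2 - X 2)) := eq_C_of_pderiv_eq_zero fun i => by
      have h3 := hω i
      rw [contactCoeff, h0, h1] at h3
      rw [map_sub, sub_eq_zero]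
      fin_cases i <;> simpa [pderiv_X] using h3
    refine ⟨coeff 0 (coordPoly (φ : polyAut 3) 2 - X 2), fun z => ?_⟩
    have h3 := congrArg (eval z) h2
    rw [map_sub, eval_X, eval_C, sub_eq_iff_eq_add'] at h3
    ext i
    rw [toMap_apply_eq_eval]
    fin_cases i
    · simp [h0]
    · simp [h1]
    · exact h3
  · rintro ⟨b, hb⟩ z
    rw [hb]
    rfl

/-! ### Lifts to contact automorphisms -/

/-- The lift `(z₀ + q'(z₁), z₁, z₂ - q(z₁))` of an elementary automorphism. -/
def liftElementary (q : Polynomial ℂ) : polyAut 3 :=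
  mkPolyAut (fun z => ![z 0 + q.derivative.eval (z 1), z 1, z 2 - q.eval (z 1)])
    (fun z => ![z 0 - q.derivative.eval (z 1), z 1, z 2 + q.eval (z 1)])
    ⟨![X 0 + Polynomial.aeval (X 1) q.derivative, X 1, X 2 - Polynomial.aeval (X 1) q],
      fun z i => by fin_cases i <;> simp [eval_aeval_X]⟩
    ⟨![X 0 - Polynomial.aeval (X 1) q.derivative, X 1, X 2 + Polynomial.aeval (X 1) q],
      fun z i => by fin_cases i <;> simp [eval_aeval_X]⟩
    (fun z => by ext i; fin_cases i <;> simp)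
    (fun z => by ext i; fin_cases i <;> simp)

/-- The lift `(-z₁, z₀, z₂ + z₀ z₁)` of the rotation. -/
def liftRotation : polyAut 3 :=
  mkPolyAut (fun z => ![-z 1, z 0, z 2 + z 0 * z 1]) (fun z => ![z 1, -z 0, z 2 + z 0 * z 1])
    ⟨![-X 1, X 0, X 2 + X 0 * X 1], fun z i => by fin_cases i <;> simp⟩
    ⟨![X 1, -X 0, X 2 + X 0 * X 1], fun z i => by fin_cases i <;> simp⟩
    (fun z => by ext i; fin_cases i <;> simp; ring)
    (fun z => by ext i; fin_cases i <;> simp; ring)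

/-- The translation `(z₀, z₁ + 1, z₂)`. -/
def unitTranslation : polyAut 3 :=
  mkPolyAut (fun z => ![z 0, z 1 + 1, z 2]) (fun z => ![z 0, z 1 - 1, z 2])
    ⟨![X 0, X 1 + 1, X 2], fun z i => by fin_cases i <;> simp⟩
    ⟨![X 0, X 1 - 1, X 2], fun z i => by fin_cases i <;> simp⟩
    (fun z => by ext i; fin_cases i <;> simp)
    (fun z => by ext i; fin_cases i <;> simp)

theorem toMap_liftElementary (q : Polynomial ℂ) (z : Aff 3) : toMap (liftElementary q) z =
    ![z 0 + q.derivative.eval (z 1), z 1, z 2 - q.eval (z 1)] := rfl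

theorem toMap_liftElementary_inv (q : Polynomial ℂ) (z : Aff 3) : toMap (liftElementary q)⁻¹ z =
    ![z 0 - q.derivative.eval (z 1), z 1, z 2 + q.eval (z 1)] := rfl

theorem toMap_liftRotation (z : Aff 3) :
    toMap liftRotation z = ![-z 1, z 0, z 2 + z 0 * z 1] := rfl

theorem toMap_unitTranslation (z : Aff 3) : toMap unitTranslation z = ![z 0, z 1 + 1, z 2] := rfl

theorem toMap_unitTranslation_inv (z : Aff 3) :
    toMap unitTranslation⁻¹ z = ![z 0, z 1 - 1, z 2] := rfl

theorem mem_autOmega_of_toMap {φ : polyAut 3} (P : Fin 3 → MvPolynomial (Fin 3) ℂ)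
    (hP : ∀ z i, toMap φ z i = eval z (P i))
    (h : ∀ i, P 0 * pderiv i (P 1) + pderiv i (P 2) = ![0, X 0, 1] i) : φ ∈ AutOmega := by
  rw [mem_autOmega_iff]
  intro i
  rw [contactCoeff, coordPoly_eq_iff.2 fun z => hP z 0, coordPoly_eq_iff.2 fun z => hP z 1,
    coordPoly_eq_iff.2 fun z => hP z 2, h]

/-- The shift of `z₀` adds `q'(z₁) dz₁ = d(q(z₁))` to `ω`, and the correction in `z₂` removes it. -/
theorem liftElementary_mem (q : Polynomial ℂ) : liftElementary q ∈ AutOmega := by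
  refine mem_autOmega_of_toMap
    ![X 0 + Polynomial.aeval (X 1) q.derivative, X 1, X 2 - Polynomial.aeval (X 1) q]
    (fun z i => ?_) fun i => ?_
  · fin_cases i <;> simp [toMap_liftElementary, eval_aeval_X]
  · fin_cases i <;> simp [pderiv_X]

/-- This is `-z₁ dz₀ + d(z₀ z₁) = z₀ dz₁`. -/
theorem liftRotation_mem : liftRotation ∈ AutOmega := by
  refine mem_autOmega_of_toMap ![-X 1, X 0, X 2 + X 0 * X 1] (fun z i => ?_) fun i => ?_
  · fin_cases i <;> simp [toMap_liftRotation]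
  · fin_cases i <;> simp [pderiv_X]

theorem unitTranslation_mem : unitTranslation ∈ AutOmega := by
  refine mem_autOmega_of_toMap ![X 0, X 1 + 1, X 2] (fun z i => ?_) fun i => ?_
  · fin_cases i <;> simp [toMap_unitTranslation]
  · fin_cases i <;> simp [pderiv_X]

theorem exists_derivative_eq (p : Polynomial ℂ) : ∃ q : Polynomial ℂ, q.derivative = p := by
  induction p using Polynomial.induction_on' with
  | add p₁ p₂ h₁ h₂ =>
    obtain ⟨q₁, rfl⟩ := h₁
    obtain ⟨q₂, rfl⟩ := h₂
    exact ⟨q₁ + q₂, Polynomial.derivative_add⟩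
  | monomial n a =>
    refine ⟨Polynomial.monomial (n + 1) (a / (n + 1)), ?_⟩
    have h : (n : ℂ) + 1 ≠ 0 := Nat.cast_add_one_ne_zero n
    rw [Polynomial.derivative_monomial]
    congr 1
    push_cast
    field_simp

/-! ### The derived groups -/

/-- `Aut(ℂ³)_ω` as a subgroup of `Aut(ℂ³)_{c(ω)}`. -/
abbrev strictContact : Subgroup AutContactOmega := AutOmega.subgroupOf AutContactOmega

theorem autEta_le_map_strictContact : AutEta ≤ strictContact.map projHom := by
  refine autEta_le (fun p => ?_) ?_
  · obtain ⟨q, rfl⟩ := exists_derivative_eq p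
    exact ⟨⟨liftElementary q, autOmega_le_autContactOmega (liftElementary_mem q)⟩,
      liftElementary_mem q, projHom_eq_iff.2 fun z => rfl⟩
  · exact ⟨⟨liftRotation, autOmega_le_autContactOmega liftRotation_mem⟩,
      liftRotation_mem, projHom_eq_iff.2 fun z => rfl⟩

/-- A Heisenberg relation: translations in `z₀` and `z₁` commute in the plane, but their lifts `(z₀
- b, z₁, z₂ + b z₁)` and `(z₀, z₁ + 1, z₂)` have commutator `(z₀, z₁, z₂ + b)`. -/
theorem mem_commutator_of_isVerticalTranslation {φ : AutContactOmega}
    (h : IsVerticalTranslation φ) : φ ∈ ⁅strictContact, strictContact⁆ := by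
  obtain ⟨b, hb⟩ := h
  set A := liftElementary (Polynomial.C (-b) * Polynomial.X) with hA
  have hA' : A ∈ AutOmega := liftElementary_mem _
  have h1 : φ = ⁅(⟨A, autOmega_le_autContactOmega hA'⟩ : AutContactOmega),
      ⟨unitTranslation, autOmega_le_autContactOmega unitTranslation_mem⟩⁆ := by
    refine Subtype.ext ?_
    change (φ : polyAut 3) = A * unitTranslation * A⁻¹ * unitTranslation⁻¹
    refine polyAut_ext fun z => ?_
    rw [hb]
    simp only [toMap_mul, Function.comp_apply, hA, toMap_liftElementary,
      toMap_liftElementary_inv, toMap_unitTranslation, toMap_unitTranslation_inv]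
    ext i
    fin_cases i
    · simp
    · simp
    · simp; ring
  rw [h1]
  exact Subgroup.commutator_mem_commutator hA' unitTranslation_mem

/-- A central-extension argument: the image `AutEta` is perfect, so `φ` agrees with a product of
commutators up to a vertical translation, itself a commutator. -/
theorem commutator_strictContact : ⁅strictContact, strictContact⁆ = strictContact := by
  refine le_antisymm (Subgroup.commutator_le_self _) fun φ hφ => ?_
  have h : projHom φ ∈ ⁅strictContact, strictContact⁆.map projHom := by
    rw [Subgroup.map_commutator]
    refine Subgroup.commutator_mono autEta_le_map_strictContact autEta_le_map_strictContact ?_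
    rw [commutator_autEta]
    exact (projHom_mem_autEta_iff φ).2 hφ
  obtain ⟨ψ, hψ, hψφ⟩ := h
  have h1 : ψ⁻¹ * φ ∈ ⁅strictContact, strictContact⁆ := by
    refine mem_commutator_of_isVerticalTranslation ((projHom_eq_one_iff _).1 ?_)
    rw [map_mul, map_inv, hψφ, inv_mul_cancel]
  exact (mul_mem_cancel_left (inv_mem hψ)).1 h1

theorem commutator_autContactOmega : commutator AutContactOmega = strictContact := by
  refine le_antisymm ?_ ?_
  · rw [commutator_def, Subgroup.commutator_le]
    exact fun φ _ ψ _ => commutatorElement_mem_autOmega φ.2 ψ.2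
  · rw [← commutator_strictContact, commutator_def]
    exact Subgroup.commutator_mono le_top le_top

theorem isPerfect_autOmega : Group.IsPerfect AutOmega := by
  have h : Group.IsPerfect strictContact := Subgroup.isPerfect_iff.2 commutator_strictContact
  have h1 := Group.IsPerfect.map (H := strictContact) AutContactOmega.subtype
  rwa [Subgroup.map_subgroupOf_eq_of_le autOmega_le_autContactOmega] at h1

/-- The homomorphism `φ ↦ (φ₀, φ₁)` on `Aut(ℂ³)_ω`. -/
def strictProjHom : AutOmega →* AutEta :=
  (projHom.comp (Subgroup.inclusion autOmega_le_autContactOmega)).codRestrict AutEta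
    fun φ => (projHom_mem_autEta_iff _).2 φ.2

end ContactAut

end

theorem mainTheorem7 :
    Group.IsPerfect (commutator ContactAut.AutOmega) ∧
    Group.IsPerfect (commutator ContactAut.AutContactOmega) ∧
    Group.IsPerfect ContactAut.AutEta ∧
    (∃ sigma : ContactAut.AutOmega →* ContactAut.AutEta,
      (∀ φ : ContactAut.AutOmega, ContactAut.IsProjection φ (sigma φ)) ∧
      (commutator ContactAut.AutOmega).map sigma = ⊤ ∧
      (∀ φ, (φ ∈ commutator ContactAut.AutOmega ∧ sigma φ = 1) ↔
        ContactAut.IsVerticalTranslation φ)) ∧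
    (∃ sigma : ContactAut.AutContactOmega →* ContactAut.polyAut 2,
      (∀ φ : ContactAut.AutContactOmega, ContactAut.IsProjection φ (sigma φ)) ∧
      (commutator ContactAut.AutContactOmega).map sigma = ContactAut.AutEta ∧
      (∀ φ, (φ ∈ commutator ContactAut.AutContactOmega ∧ sigma φ = 1) ↔
        ContactAut.IsVerticalTranslation φ)) := by
  -- Both derived groups are the perfect group `AutOmega`; the remaining claims are statements about
  -- it.
  have hω : commutator ContactAut.AutOmega = ⊤ :=
    Group.isPerfect_def.1 ContactAut.isPerfect_autOmega
  refine ⟨?_, ?_, ?_, ⟨ContactAut.strictProjHom, ?_, ?_, ?_⟩, ⟨ContactAut.projHom, ?_, ?_, ?_⟩⟩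
  · rw [hω, Group.IsPerfect.top_iff]
    exact ContactAut.isPerfect_autOmega
  · rw [ContactAut.commutator_autContactOmega, Subgroup.isPerfect_iff]
    exact ContactAut.commutator_strictContact
  · rw [Subgroup.isPerfect_iff]
    exact ContactAut.commutator_autEta
  · exact fun φ => ContactAut.isProjection_projHom _
  · rw [hω, ← MonoidHom.range_eq_map, MonoidHom.range_eq_top]
    intro ψ
    obtain ⟨φ, hφ, hφψ⟩ := ContactAut.autEta_le_map_strictContact ψ.2
    exact ⟨⟨φ, hφ⟩, Subtype.ext hφψ⟩
  · intro φ
    rw [hω, ← OneMemClass.coe_eq_one]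
    exact (and_iff_right (Subgroup.mem_top φ)).trans (ContactAut.projHom_eq_one_iff
      (Subgroup.inclusion ContactAut.autOmega_le_autContactOmega φ))
  · exact ContactAut.isProjection_projHom
  · rw [ContactAut.commutator_autContactOmega]
    refine le_antisymm ?_ ContactAut.autEta_le_map_strictContact
    rintro _ ⟨φ, hφ, rfl⟩
    exact (ContactAut.projHom_mem_autEta_iff φ).2 hφ
  · intro φ
    rw [ContactAut.projHom_eq_one_iff]
    refine and_iff_right_of_imp fun h => ?_
    rw [ContactAut.commutator_autContactOmega, ← ContactAut.commutator_strictContact]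
    exact ContactAut.mem_commutator_of_isVerticalTranslation h
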